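/- Let $n\ge 3000$, and let $\eta_0,\dots,\eta_K>0$ be any finite list of learning rates. Then there exist a dimension $d$, a closed convex set $\mathcal X\subseteq\mathbb R^d$ containing $0$, a random variable $S$, and a loss $f(x;S)$ that is convex in $x\in\mathcal X$ and almost surely $1$-Lipschitz in $x$ (Euclidean norm), with finite expectation $F(x)=\mathbb E[f(x;S)]$ and $F^\star=\inf_{x\in\mathcal X}F(x)=F(0)$ (so the origin is a minimizer), such that the following holds. Let $S_1,\dots,S_{2n}$ be i.i.d. copies of $S$, write $f_i(x)=f(x;S_i)$, and regard $f_1,\dots,f_n$ as the validation set and $f_{n+1},\dots,f_{2n}$ as the training set. Let $\nabla f(x;s)$ denote an arbitrary fixed choice of subgradients. For $R>0$ let $\mathrm{AdaSGD}(R)=\frac1n\sum_{t=1}^n u_t$ be the output of adaptive SGD with learning rate $R$, where $u_1=0$ and $$u_{t+1}=\mathrm{proj}_R\left(u_t-R\,\frac{\nabla f_{n+t}(u_t)}{\sqrt{\sum_{j=1}^t\|\nabla f_{n+j}(u_j)\|_2^2}}\right),\qquad \mathrm{proj}_R(v)=\operatorname*{argmin}_{u\in\mathcal X:\ \|u\|_2\le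 R}\|u-v\|_2$$ (with the convention $0/0=0$). Put $x_k=\mathrm{AdaSGD}(\eta_k)$ for $k=0,\dots,K$. Then, with probability at least $1/1000$, every index $\hat k\in\operatorname*{argmin}_{0\le k\le K}\frac1n\sum_{i=1}^n f_i(x_k)$ that standard model selection (minimizing the validation loss) may return satisfies $$F(x_{\hat k})-F^\star\ \ge\ \frac{1}{288\sqrt n}\,\max_{0\le k\le K}\eta_k .$$ -/

import Mathlib

open MeasureTheory ProbabilityTheory

/-- A stochastic convex optimization problem on a closed convex domain `X ⊆ ℝ^d`: minimize
`F x = 𝔼[f(x; S)]` over `X`, where `S` is a random sample with law `law` and every `f(·; s)` is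
convex on `X`. The domain contains the origin, which is the reference (starting) model. -/
structure StochConvexProblem (d : ℕ) (𝒮 : Type*) [MeasurableSpace 𝒮] where
  domain : Set (EuclideanSpace ℝ (Fin d))
  isClosed_domain : IsClosed domain
  convex_domain : Convex ℝ domain
  zero_mem : (0 : EuclideanSpace ℝ (Fin d)) ∈ domain
  law : Measure 𝒮
  isProb : IsProbabilityMeasure law
  loss : EuclideanSpace ℝ (Fin d) → 𝒮 → ℝ
  convexOn_loss : ∀ s, ConvexOn ℝ domain (fun x => loss x s)
  integrable_loss : ∀ x ∈ domain, Integrable (loss x) law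
  bddBelow_risk : BddBelow ((fun x => ∫ s, loss x s ∂law) '' domain)

/-- The set of minimizers of `‖u - v‖₂` over `u ∈ X` with `‖u‖₂ ≤ R`. -/
def nearestPoints {d : ℕ} (X : Set (EuclideanSpace ℝ (Fin d))) (R : ℝ)
    (v : EuclideanSpace ℝ (Fin d)) : Set (EuclideanSpace ℝ (Fin d)) :=
  {u | (u ∈ X ∧ ‖u‖ ≤ R) ∧ ∀ w ∈ X, ‖w‖ ≤ R → ‖u - v‖ ≤ ‖w - v‖}

/-- The projection `proj_R v = argmin_{u ∈ X, ‖u‖₂ ≤ R} ‖u - v‖₂`. For `X` closed and convex with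
`0 ∈ X` and `R ≥ 0` it is the unique nearest point
(`projBall_mem`, `eq_projBall_of_mem`). -/
noncomputable def projBall {d : ℕ} (X : Set (EuclideanSpace ℝ (Fin d))) (R : ℝ)
    (v : EuclideanSpace ℝ (Fin d)) : EuclideanSpace ℝ (Fin d) :=
  Classical.epsilon (fun u => u ∈ nearestPoints X R v)

theorem projBall_mem {d : ℕ} {X : Set (EuclideanSpace ℝ (Fin d))} (hX : IsClosed X)
    (h0 : 0 ∈ X) {R : ℝ} (hR : 0 ≤ R) (v : EuclideanSpace ℝ (Fin d)) :
    projBall X R v ∈ nearestPoints X R v := by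
  apply Classical.epsilon_spec (p := fun u => u ∈ nearestPoints X R v)
  have hc : IsCompact (X ∩ Metric.closedBall 0 R) :=
    (isCompact_closedBall _ _).inter_left hX
  obtain ⟨u, hu, hmin⟩ := hc.exists_isMinOn ⟨0, h0, by simpa using hR⟩
    (f := fun u => ‖u - v‖) (by fun_prop)
  refine ⟨u, ⟨hu.1, by simpa using hu.2⟩, fun w hw hwR => hmin ⟨hw, by simpa using hwR⟩⟩

theorem eq_projBall_of_mem {d : ℕ} {X : Set (EuclideanSpace ℝ (Fin d))} (hX : IsClosed X)
    (hconv : Convex ℝ X) (h0 : 0 ∈ X) {R : ℝ} (hR : 0 ≤ R) {u v : EuclideanSpace ℝ (Fin d)}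
    (hu : u ∈ nearestPoints X R v) : u = projBall X R v := by
  obtain ⟨⟨hpX, hpR⟩, hp⟩ := projBall_mem hX h0 hR v
  obtain ⟨⟨huX, huR⟩, hu⟩ := hu
  set p := projBall X R v
  have hball : Convex ℝ (X ∩ Metric.closedBall 0 R) := hconv.inter (convex_closedBall _ _)
  have hm : (1 / 2 : ℝ) • u + (1 / 2 : ℝ) • p ∈ X ∩ Metric.closedBall 0 R :=
    hball ⟨huX, by simpa using huR⟩ ⟨hpX, by simpa using hpR⟩ (by norm_num) (by norm_num)
      (by norm_num)
  have h1 := hu _ hm.1 (by simpa using hm.2)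
  have h2 := hu p hpX hpR
  have h3 := hp u huX huR
  have e : (1 / 2 : ℝ) • u + (1 / 2 : ℝ) • p - v = (1 / 2 : ℝ) • ((u - v) + (p - v)) := by
    module
  rw [e, norm_smul, Real.norm_of_nonneg (by norm_num)] at h1
  have par := parallelogram_law_with_norm ℝ (u - v) (p - v)
  have e2 : (u - v) - (p - v) = u - p := by abel
  rw [e2] at par
  have h4 : ‖u - p‖ * ‖u - p‖ ≤ 0 := by
    nlinarith [norm_nonneg (u - v), norm_nonneg (p - v), norm_nonneg ((u - v) + (p - v))]
  have h5 : ‖u - p‖ = 0 := by nlinarith [norm_nonneg (u - p)]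
  exact sub_eq_zero.mp (norm_eq_zero.mp h5)

namespace StochConvexProblem

variable {d : ℕ} {𝒮 : Type*} [MeasurableSpace 𝒮] (P : StochConvexProblem d 𝒮)

/-- The population risk `F x = 𝔼[f(x; S)]`. -/
noncomputable def risk (x : EuclideanSpace ℝ (Fin d)) : ℝ := ∫ s, P.loss x s ∂P.law

/-- `F⋆ = inf_{x ∈ X} F x`. -/
noncomputable def optRisk : ℝ := sInf (P.risk '' P.domain)

/-- `f` is `L`-Lipschitz: almost surely `f(·; S)` is `L`-Lipschitz on the domain. -/
def IsLipschitz (L : ℝ) : Prop :=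
  ∀ᵐ s ∂P.law, ∀ x ∈ P.domain, ∀ y ∈ P.domain, |P.loss x s - P.loss y s| ≤ L * ‖x - y‖

/-- `v` is a subgradient at `x` of the convex function `f(·; s)` on the domain. -/
def IsSubgradient (x : EuclideanSpace ℝ (Fin d)) (s : 𝒮) (v : EuclideanSpace ℝ (Fin d)) : Prop :=
  ∀ y ∈ P.domain, P.loss x s + inner ℝ v (y - x) ≤ P.loss y s

/-- `g` is a choice of subgradients: `g x s` plays the role of `∇f(x; s)`, which stands for an
arbitrary subgradient of `f(·; s)` at `x`. -/
def IsSubgradientOracle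
    (g : EuclideanSpace ℝ (Fin d) → 𝒮 → EuclideanSpace ℝ (Fin d)) : Prop :=
  ∀ᵐ s ∂P.law, ∀ x ∈ P.domain, P.IsSubgradient x s (g x s)

/-- The state `(u_{t+1}, ∑_{j=1}^t ‖∇f(u_j; z_j)‖²)` of adaptive SGD with learning rate `R`
after processing the training samples `z 1, …, z t`, started from `u_1 = 0`. If all gradients
seen so far vanish, the iterate does not move (`0 / 0 = 0`). -/
noncomputable def adaSGDState (g : EuclideanSpace ℝ (Fin d) → 𝒮 → EuclideanSpace ℝ (Fin d))
    (R : ℝ) (z : ℕ → 𝒮) : ℕ → EuclideanSpace ℝ (Fin d) × ℝ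
  | 0 => (0, 0)
  | t + 1 =>
    let u := (adaSGDState g R z t).1
    let v := g u (z (t + 1))
    let G := (adaSGDState g R z t).2 + ‖v‖ ^ 2
    (projBall P.domain R (u - (R / √G) • v), G)

/-- The iterate `u_t` of adaptive SGD, for `t ≥ 1`. -/
noncomputable def adaSGDIter (g : EuclideanSpace ℝ (Fin d) → 𝒮 → EuclideanSpace ℝ (Fin d))
    (R : ℝ) (z : ℕ → 𝒮) (t : ℕ) : EuclideanSpace ℝ (Fin d) :=
  (P.adaSGDState g R z (t - 1)).1

/-- The output `(1/n) ∑_{t=1}^n u_t` of adaptive SGD on the training samples `z 1, …, z n`. -/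
noncomputable def adaSGD (g : EuclideanSpace ℝ (Fin d) → 𝒮 → EuclideanSpace ℝ (Fin d))
    (R : ℝ) (n : ℕ) (z : ℕ → 𝒮) : EuclideanSpace ℝ (Fin d) :=
  (1 / (n : ℝ)) • ∑ t ∈ Finset.Icc 1 n, P.adaSGDIter g R z t

theorem adaSGDIter_one (g : EuclideanSpace ℝ (Fin d) → 𝒮 → EuclideanSpace ℝ (Fin d))
    (R : ℝ) (z : ℕ → 𝒮) : P.adaSGDIter g R z 1 = 0 := rfl

theorem adaSGDState_snd (g : EuclideanSpace ℝ (Fin d) → 𝒮 → EuclideanSpace ℝ (Fin d))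
    (R : ℝ) (z : ℕ → 𝒮) (t : ℕ) : (P.adaSGDState g R z t).2 =
      ∑ j ∈ Finset.Icc 1 t, ‖g (P.adaSGDIter g R z j) (z j)‖ ^ 2 := by
  induction t with
  | zero => rfl
  | succ t ih =>
    rw [Finset.sum_Icc_succ_top (by omega), ← ih]
    rfl

/-- The defining recursion of adaptive SGD. -/
theorem adaSGDIter_succ (g : EuclideanSpace ℝ (Fin d) → 𝒮 → EuclideanSpace ℝ (Fin d))
    (R : ℝ) (z : ℕ → 𝒮) {t : ℕ} (ht : 1 ≤ t) : P.adaSGDIter g R z (t + 1) =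
      projBall P.domain R (P.adaSGDIter g R z t -
        (R / √(∑ j ∈ Finset.Icc 1 t, ‖g (P.adaSGDIter g R z j) (z j)‖ ^ 2)) •
          g (P.adaSGDIter g R z t) (z t)) := by
  obtain ⟨t, rfl⟩ : ∃ m, t = m + 1 := ⟨t - 1, by omega⟩
  rw [← P.adaSGDState_snd]
  rfl

/-- The validation loss `(1/n) ∑_{i=1}^n f(x; z_i)`. -/
noncomputable def empRisk (n : ℕ) (z : ℕ → 𝒮) (x : EuclideanSpace ℝ (Fin d)) : ℝ :=
  (1 / (n : ℝ)) * ∑ i ∈ Finset.Icc 1 n, P.loss x (z i)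

/-- The indices that standard model selection may return: those of the models in the list `x`
that minimize the loss on the validation samples `z 1, …, z n`. -/
def greedySelection (n : ℕ) (z : ℕ → 𝒮) {ι : Type*} (x : ι → EuclideanSpace ℝ (Fin d)) : Set ι :=
  {k | ∀ j, P.empRisk n z (x k) ≤ P.empRisk n z (x j)}

end StochConvexProblem

/-- `Q` holds with probability at least `p`: it holds throughout a measurable event of probability
at least `p` (so no measurability of `Q` is presupposed). -/
def WithProbAtLeast {Ω : Type*} [MeasurableSpace Ω] (μ : Measure Ω) (p : ℝ) (Q : Ω → Prop) : Prop :=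
  ∃ A : Set Ω, MeasurableSet A ∧ p ≤ μ.real A ∧ ∀ ω ∈ A, Q ω

/-!
The losses are `± (1 - ε) x + ε |x|` on the real line with a fair random sign and `ε` of order
`1 / √n`, so that the risk is `ε |x|`. They are positively homogeneous, hence adaptive SGD with
learning rate `η` returns `η` times its output `x₁` for learning rate `1`: all candidate models lie
on one ray, and as soon as the validation loss of `x₁` is negative, selection picks the largest `η`.

Up to a small error, `x₁` is the time average `Y` of the walk on `[-1, 1]` with steps `∓1 / √t`.
For the position `u` of this walk, `𝔼 cos (π u)` is multiplied by at most `cos (π / √t)` in step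
`t`, which is `0` at `t = 4` and nonnegative afterwards; this bounds `𝔼 u²`, and then `𝔼 Y²`, from
below, so that `|Y|` exceeds a constant with constant probability. Independently of `Y`, the sum `V`
of the validation signs is of order `√n` with constant probability by the Paley–Zygmund inequality,
and by symmetry its sign is opposite to that of `Y` half of the time. In this event the noise
`(1 - ε) x₁ V / n` outweighs the risk `ε |x₁|`, and the validation loss of `x₁` is negative.
-/

section Anticoncentration

variable {Ω : Type*} [MeasurableSpace Ω] {μ : Measure Ω}

theorem sq_setIntegral_le_measureReal_mul_integral_sq [IsFiniteMeasure μ] {Z : Ω → ℝ}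
    (hZ : MemLp Z 2 μ) (s : Set Ω) :
    (∫ ω in s, Z ω ∂μ) ^ 2 ≤ μ.real s * ∫ ω, Z ω ^ 2 ∂μ := by
  have hZs : Integrable Z (μ.restrict s) := (hZ.restrict s).integrable one_le_two
  have hsq : Integrable (fun ω => Z ω ^ 2) (μ.restrict s) := (hZ.restrict s).integrable_sq
  have hquad (c : ℝ) : 0 ≤ μ.real s * (c * c) + -(2 * ∫ ω in s, Z ω ∂μ) * c +
      ∫ ω in s, Z ω ^ 2 ∂μ := by
    calc 0 ≤ ∫ ω in s, (Z ω - c) ^ 2 ∂μ := integral_nonneg fun ω => sq_nonneg _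
      _ = ∫ ω in s, (Z ω ^ 2 + (-(2 * c)) * Z ω + c * c) ∂μ := by
        congr 1 with ω
        ring
      _ = _ := by
        rw [integral_add (by fun_prop) (by fun_prop), integral_add hsq (by fun_prop),
          integral_const_mul, setIntegral_const, smul_eq_mul]
        ring
  have hdiscrim := discrim_le_zero hquad
  have hmono : ∫ ω in s, Z ω ^ 2 ∂μ ≤ ∫ ω, Z ω ^ 2 ∂μ :=
    setIntegral_le_integral hZ.integrable_sq (ae_of_all _ fun ω => sq_nonneg _)
  rw [discrim] at hdiscrim
  nlinarith [mul_le_mul_of_nonneg_left hmono (measureReal_nonneg (μ := μ) (s := s))]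

/-- The Paley–Zygmund inequality. -/
theorem sq_integral_sub_le_integral_sq_mul_measureReal [IsProbabilityMeasure μ] {Z : Ω → ℝ}
    (hZ : MemLp Z 2 μ) {θ : ℝ} (h0 : 0 ≤ θ) (hθ : θ ≤ ∫ ω, Z ω ∂μ) :
    (∫ ω, Z ω ∂μ - θ) ^ 2 ≤ (∫ ω, Z ω ^ 2 ∂μ) * μ.real {ω | θ ≤ Z ω} := by
  have hint : Integrable Z μ := hZ.integrable one_le_two
  have hs : NullMeasurableSet {ω | θ ≤ Z ω} μ := nullMeasurableSet_le aemeasurable_const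
    hZ.aestronglyMeasurable.aemeasurable
  have hcompl : ∫ ω in {ω | θ ≤ Z ω}ᶜ, Z ω ∂μ ≤ θ := by
    calc ∫ ω in {ω | θ ≤ Z ω}ᶜ, Z ω ∂μ ≤ ∫ _ in {ω | θ ≤ Z ω}ᶜ, θ ∂μ := by
          refine setIntegral_mono_on₀ hint.integrableOn (integrableOn_const) hs.compl fun ω hω => ?_
          exact le_of_not_ge (by simpa using hω)
      _ = μ.real {ω | θ ≤ Z ω}ᶜ * θ := by rw [setIntegral_const, smul_eq_mul]
      _ ≤ θ := mul_le_of_le_one_left h0 measureReal_le_one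
  have hsplit := integral_add_compl₀ hs hint
  calc (∫ ω, Z ω ∂μ - θ) ^ 2 ≤ (∫ ω in {ω | θ ≤ Z ω}, Z ω ∂μ) ^ 2 :=
        pow_le_pow_left₀ (sub_nonneg.2 hθ) (by linarith) 2
    _ ≤ _ := (sq_setIntegral_le_measureReal_mul_integral_sq hZ _).trans_eq (mul_comm _ _)

theorem integral_sub_le_measureReal_of_le_one [IsProbabilityMeasure μ] {Z : Ω → ℝ}
    (hZ : Integrable Z μ) (h1 : ∀ᵐ ω ∂μ, Z ω ≤ 1) {θ : ℝ} (h0 : 0 ≤ θ) :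
    ∫ ω, Z ω ∂μ - θ ≤ μ.real {ω | θ ≤ Z ω} := by
  have hs : NullMeasurableSet {ω | θ ≤ Z ω} μ := nullMeasurableSet_le aemeasurable_const
    hZ.aemeasurable
  have hind : Integrable ({ω | θ ≤ Z ω}.indicator fun _ => (1 : ℝ)) μ :=
    (integrable_const 1).indicator₀ hs
  have hle : ∫ ω, Z ω ∂μ ≤ ∫ ω, (θ + {ω | θ ≤ Z ω}.indicator (fun _ => (1 : ℝ)) ω) ∂μ := by
    refine integral_mono_ae hZ ((integrable_const θ).add hind) ?_
    filter_upwards [h1] with ω hω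
    by_cases hθ : θ ≤ Z ω
    · simpa [hθ] using hω.trans (le_add_of_nonneg_left h0)
    · simpa [hθ] using (not_le.1 hθ).le
  rw [integral_add (integrable_const θ) hind, integral_indicator₀ hs, setIntegral_const] at hle
  simp only [integral_const, probReal_univ, smul_eq_mul, one_mul, mul_one] at hle
  linarith

theorem measureReal_mul_neg_of_indepFun_of_symmetric [IsFiniteMeasure μ] {Y V : Ω → ℝ}
    (hYV : IndepFun Y V μ) (hY : AEMeasurable Y μ) (hV : IdentDistrib V (-V) μ μ)
    {a b : ℝ} (ha : 0 < a) (hb : 0 < b) :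
    μ.real {ω | a ≤ |Y ω| ∧ b ≤ |V ω| ∧ Y ω * V ω < 0} =
      1 / 2 * (μ.real {ω | a ≤ |Y ω|} * μ.real {ω | b ≤ |V ω|}) := by
  set A := {ω | a ≤ |Y ω|}
  set B := {ω | b ≤ |V ω|}
  have hflip : μ.real {ω | a ≤ |Y ω| ∧ b ≤ |V ω| ∧ Y ω * V ω < 0} =
      μ.real {ω | a ≤ |Y ω| ∧ b ≤ |V ω| ∧ 0 < Y ω * V ω} := by
    have hpair : IdentDistrib (fun ω => (Y ω, V ω)) (fun ω => (Y ω, -V ω)) μ μ :=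
      (IdentDistrib.refl hY).prodMk hV hYV (hYV.comp measurable_id measurable_neg)
    have hmeas : MeasurableSet {p : ℝ × ℝ | a ≤ |p.1| ∧ b ≤ |p.2| ∧ p.1 * p.2 < 0} := by
      measurability
    simpa [Set.preimage, Measure.real] using congrArg ENNReal.toReal (hpair.measure_mem_eq hmeas)
  have hunion : A ∩ B = {ω | a ≤ |Y ω| ∧ b ≤ |V ω| ∧ Y ω * V ω < 0} ∪
      {ω | a ≤ |Y ω| ∧ b ≤ |V ω| ∧ 0 < Y ω * V ω} := by
    ext ω
    have hne (hYω : a ≤ |Y ω|) (hVω : b ≤ |V ω|) : Y ω * V ω ≠ 0 :=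
      mul_ne_zero (abs_pos.1 (ha.trans_le hYω)) (abs_pos.1 (hb.trans_le hVω))
    grind
  have hprod : μ.real (A ∩ B) = μ.real A * μ.real B := by
    rw [Measure.real, Measure.real, Measure.real, ← ENNReal.toReal_mul]
    exact congrArg ENNReal.toReal <| hYV.measure_inter_preimage_eq_mul {y | a ≤ |y|} {v | b ≤ |v|}
      (measurableSet_le measurable_const measurable_abs)
      (measurableSet_le measurable_const measurable_abs)
  have hpos : NullMeasurableSet {ω | a ≤ |Y ω| ∧ b ≤ |V ω| ∧ 0 < Y ω * V ω} μ :=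
    (hY.prodMk hV.aemeasurable_fst).nullMeasurableSet_preimage
      (s := {p : ℝ × ℝ | a ≤ |p.1| ∧ b ≤ |p.2| ∧ 0 < p.1 * p.2}) (by measurability)
  have hdisj : Disjoint {ω | a ≤ |Y ω| ∧ b ≤ |V ω| ∧ Y ω * V ω < 0}
      {ω | a ≤ |Y ω| ∧ b ≤ |V ω| ∧ 0 < Y ω * V ω} :=
    Set.disjoint_left.2 fun ω hneg hpos => lt_asymm hneg.2.2 hpos.2.2
  rw [hunion, measureReal_union₀ hpos hdisj.aedisjoint, ← hflip] at hprod
  linarith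

end Anticoncentration

theorem withProbAtLeast_of_nullMeasurableSet {Ω : Type*} [MeasurableSpace Ω] {μ : Measure Ω}
    {p : ℝ} {Q : Ω → Prop} (hQ : NullMeasurableSet {ω | Q ω} μ) (hp : p ≤ μ.real {ω | Q ω}) :
    WithProbAtLeast μ p Q := by
  obtain ⟨A, hAQ, hA, hAe⟩ := hQ.exists_measurable_subset_ae_eq
  exact ⟨A, hA, hp.trans_eq (measureReal_congr hAe).symm, fun ω hω => hAQ hω⟩

theorem indepFun_tuples_of_disjoint_range {Ω ι κ κ' : Type*} [MeasurableSpace Ω] {μ : Measure Ω}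
    [Finite κ] [Finite κ'] {β : Type*} [MeasurableSpace β] {X : ι → Ω → β}
    (hX : iIndepFun X μ) (hm : ∀ i, AEMeasurable (X i) μ) {f : κ → ι} {g : κ' → ι}
    (hfg : Disjoint (Set.range f) (Set.range g)) :
    IndepFun (fun ω k => X (f k) ω) (fun ω k => X (g k) ω) μ := by
  classical
  cases nonempty_fintype κ
  cases nonempty_fintype κ'
  have hdisj : Disjoint (Finset.univ.image f) (Finset.univ.image g) := by
    simpa [← Finset.disjoint_coe] using hfg
  exact (hX.indepFun_finset₀ _ _ hdisj hm).comp
    (φ := fun (x : Finset.univ.image f → β) k => x ⟨f k, by simp⟩)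
    (ψ := fun (x : Finset.univ.image g → β) k => x ⟨g k, by simp⟩) (by fun_prop) (by fun_prop)

/-- The real-valued sign of a bit, `1` for `true` and `-1` for `false`. -/
noncomputable def bitSign (b : Bool) : ℝ := if b then 1 else -1

theorem bitSign_not (b : Bool) : bitSign (!b) = -bitSign b := by
  cases b <;> simp [bitSign]

theorem bitSign_sq (b : Bool) : bitSign b ^ 2 = 1 := by
  cases b <;> simp [bitSign]

theorem abs_bitSign (b : Bool) : |bitSign b| = 1 := by
  cases b <;> simp [bitSign]

/-- The law of a fair bit. -/
noncomputable def fairBit : Measure Bool := (PMF.uniformOfFintype Bool).toMeasure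

instance : IsProbabilityMeasure fairBit := by
  unfold fairBit
  infer_instance

theorem integral_fairBit (f : Bool → ℝ) : ∫ b, f b ∂fairBit = (f true + f false) / 2 := by
  rw [fairBit, PMF.integral_eq_sum]
  simp [div_eq_inv_mul, mul_add]

theorem ae_fairBit_iff {p : Bool → Prop} : (∀ᵐ b ∂fairBit, p b) ↔ ∀ b, p b := by
  have hne (b : Bool) : fairBit {b} ≠ 0 := by simp [fairBit]
  exact ⟨fun h b => by_contra fun hb => hne b (measure_mono_null (by simpa using hb) (ae_iff.1 h)),
    ae_of_all _⟩

theorem measurePreserving_not_fairBit : MeasurePreserving not fairBit fairBit := by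
  refine ⟨measurable_of_finite _, Measure.ext_of_singleton fun b => ?_⟩
  have hpre : not ⁻¹' {b} = {!b} := by
    ext c
    cases b <;> cases c <;> simp
  rw [Measure.map_apply (measurable_of_finite _) (measurableSet_singleton b), hpre]
  simp [fairBit]

/-- The law of a family of independent fair bits indexed by `ι`. -/
noncomputable def fairBits (ι : Type*) [Fintype ι] : Measure (ι → Bool) :=
  Measure.pi fun _ => fairBit

section fairBits

variable {ι : Type*} [Fintype ι]

instance : IsProbabilityMeasure (fairBits ι) := by
  unfold fairBits
  infer_instance

theorem measurePreserving_not_fairBits :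
    MeasurePreserving (fun b i => !b i) (fairBits ι) (fairBits ι) :=
  measurePreserving_pi _ _ fun _ => measurePreserving_not_fairBit

variable [DecidableEq ι]

theorem measurePreserving_update_not_fairBits (i : ι) :
    MeasurePreserving (fun b => Function.update b i (!b i)) (fairBits ι) (fairBits ι) := by
  have h := measurePreserving_pi (fun _ : ι => fairBit) (fun _ => fairBit)
    (f := Function.update (fun _ => id) i not) fun j => by
      rcases eq_or_ne j i with rfl | hj
      · simpa using measurePreserving_not_fairBit
      · simpa [hj] using MeasurePreserving.id fairBit
  rw [fairBits]
  convert h using 1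
  funext b j
  rcases eq_or_ne j i with rfl | hj <;> simp [*]

theorem integral_fairBits_eq_integral_update (i : ι) (F : (ι → Bool) → ℝ) :
    ∫ b, F b ∂fairBits ι =
      ∫ b, (F (Function.update b i true) + F (Function.update b i false)) / 2 ∂fairBits ι := by
  have hflip : ∫ b, F (Function.update b i (!b i)) ∂fairBits ι = ∫ b, F b ∂fairBits ι :=
    (measurePreserving_update_not_fairBits i).hasLaw.integral_comp (f := F) (by fun_prop)
  calc ∫ b, F b ∂fairBits ι = ∫ b, (F b + F (Function.update b i (!b i))) / 2 ∂fairBits ι := by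
        rw [integral_div, integral_add .of_finite .of_finite, hflip, add_self_div_two]
    _ = _ := by
        congr 1 with b
        have hself := Function.update_eq_self i b
        cases hb : b i <;> rw [hb] at hself <;> simp [hself, add_comm]

end fairBits

section SignSum

variable {ι : Type*} [Fintype ι]

theorem integral_sum_insert_mul_bitSign [DecidableEq ι] (a : ι → ℝ) {s : Finset ι} {i : ι}
    (hi : i ∉ s) (φ : ℝ → ℝ) :
    ∫ b, φ (∑ j ∈ insert i s, a j * bitSign (b j)) ∂fairBits ι =
      ∫ b, (φ (∑ j ∈ s, a j * bitSign (b j) + a i) +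
        φ (∑ j ∈ s, a j * bitSign (b j) - a i)) / 2 ∂fairBits ι := by
  have hsum (b : ι → Bool) (c : Bool) :
      ∑ j ∈ insert i s, a j * bitSign (Function.update b i c j) =
        ∑ j ∈ s, a j * bitSign (b j) + a i * bitSign c := by
    rw [Finset.sum_insert hi, Function.update_self, add_comm]
    congr 1
    exact Finset.sum_congr rfl fun j hj => by
      rw [Function.update_of_ne (ne_of_mem_of_not_mem hj hi)]
  rw [integral_fairBits_eq_integral_update i]
  simp only [hsum]
  simp [bitSign, sub_eq_add_neg]

theorem integral_sum_mul_bitSign_sq (a : ι → ℝ) (s : Finset ι) :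
    ∫ b, (∑ i ∈ s, a i * bitSign (b i)) ^ 2 ∂fairBits ι = ∑ i ∈ s, a i ^ 2 := by
  classical
  induction s using Finset.induction_on with
  | empty => simp
  | insert i s hi ih =>
    calc ∫ b, (∑ j ∈ insert i s, a j * bitSign (b j)) ^ 2 ∂fairBits ι
        = ∫ b, ((∑ j ∈ s, a j * bitSign (b j)) ^ 2 + a i ^ 2) ∂fairBits ι := by
          rw [integral_sum_insert_mul_bitSign a hi (· ^ 2)]
          congr 1 with b
          ring
      _ = ∑ j ∈ insert i s, a j ^ 2 := by
          rw [integral_add .of_finite .of_finite, ih, integral_const, Finset.sum_insert hi]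
          simp [add_comm]

theorem integral_sum_mul_bitSign_pow_four_le (a : ι → ℝ) (s : Finset ι) :
    ∫ b, (∑ i ∈ s, a i * bitSign (b i)) ^ 4 ∂fairBits ι ≤ 3 * (∑ i ∈ s, a i ^ 2) ^ 2 := by
  classical
  induction s using Finset.induction_on with
  | empty => simp
  | insert i s hi ih =>
    calc ∫ b, (∑ j ∈ insert i s, a j * bitSign (b j)) ^ 4 ∂fairBits ι
        = ∫ b, ((∑ j ∈ s, a j * bitSign (b j)) ^ 4 +
            6 * a i ^ 2 * (∑ j ∈ s, a j * bitSign (b j)) ^ 2 + a i ^ 4) ∂fairBits ι := by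
          rw [integral_sum_insert_mul_bitSign a hi (· ^ 4)]
          congr 1 with b
          ring
      _ = ∫ b, (∑ j ∈ s, a j * bitSign (b j)) ^ 4 ∂fairBits ι +
            6 * a i ^ 2 * ∑ j ∈ s, a j ^ 2 + a i ^ 4 := by
          rw [integral_add .of_finite .of_finite, integral_add .of_finite .of_finite,
            integral_const_mul, integral_sum_mul_bitSign_sq, integral_const]
          simp
      _ ≤ 3 * (∑ j ∈ insert i s, a j ^ 2) ^ 2 := by
          rw [Finset.sum_insert hi]
          nlinarith [sq_nonneg (a i ^ 2)]

theorem one_sub_sq_div_three_le_measureReal_sum_mul_bitSign_sq (a : ι → ℝ) {c : ℝ} (h0 : 0 ≤ c)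
    (h1 : c ≤ 1) :
    (1 - c) ^ 2 / 3 ≤
      (fairBits ι).real {b | c * ∑ i, a i ^ 2 ≤ (∑ i, a i * bitSign (b i)) ^ 2} := by
  set A := ∑ i, a i ^ 2
  have hA0 : 0 ≤ A := Finset.sum_nonneg fun i _ => sq_nonneg _
  rcases hA0.eq_or_lt with hzero | hpos
  · have huniv : {b : ι → Bool | c * A ≤ (∑ i, a i * bitSign (b i)) ^ 2} = Set.univ :=
      Set.eq_univ_of_forall fun b => by simpa [← hzero] using sq_nonneg _
    rw [huniv, probReal_univ]
    nlinarith
  · have hmean : ∫ b, (∑ i, a i * bitSign (b i)) ^ 2 ∂fairBits ι = A :=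
      integral_sum_mul_bitSign_sq a _
    have hsq : ∫ b, ((∑ i, a i * bitSign (b i)) ^ 2) ^ 2 ∂fairBits ι ≤ 3 * A ^ 2 := by
      simpa only [← pow_mul] using integral_sum_mul_bitSign_pow_four_le a Finset.univ
    have hPZ := sq_integral_sub_le_integral_sq_mul_measureReal (μ := fairBits ι)
      (Z := fun b => (∑ i, a i * bitSign (b i)) ^ 2) (θ := c * A) .of_discrete (by positivity)
      (by rw [hmean]; exact mul_le_of_le_one_left hA0 h1)
    rw [hmean] at hPZ
    have hbound := hPZ.trans (mul_le_mul_of_nonneg_right hsq measureReal_nonneg)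
    rw [div_le_iff₀ (by norm_num), ← mul_le_mul_iff_left₀ (pow_pos hpos 2)]
    linarith

end SignSum

/-- The projection of the real line onto `[-1, 1]`. -/
noncomputable def clampUnit (y : ℝ) : ℝ := Set.projIcc (-1) 1 (by norm_num) y

theorem abs_clampUnit_le (y : ℝ) : |clampUnit y| ≤ 1 :=
  abs_le.2 (Set.projIcc (-1) 1 (by norm_num) y).2

theorem clampUnit_of_abs_le {y : ℝ} (h : |y| ≤ 1) : clampUnit y = y := by
  rw [clampUnit, Set.projIcc_of_mem _ (abs_le.1 h)]

theorem clampUnit_of_one_le {y : ℝ} (h : 1 ≤ y) : clampUnit y = 1 := by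
  rw [clampUnit, Set.projIcc_of_right_le _ h]

theorem clampUnit_of_le_neg_one {y : ℝ} (h : y ≤ -1) : clampUnit y = -1 := by
  rw [clampUnit, Set.projIcc_of_le_left _ h]

theorem monotone_clampUnit : Monotone clampUnit := fun _ _ h => Set.monotone_projIcc _ h

theorem clampUnit_neg (y : ℝ) : clampUnit (-y) = -clampUnit y := by
  rcases le_total y (-1) with h | h
  · rw [clampUnit_of_le_neg_one h, clampUnit_of_one_le (by linarith), neg_neg]
  rcases le_total 1 y with h' | h'
  · rw [clampUnit_of_one_le h', clampUnit_of_le_neg_one (by linarith)]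
  · rw [clampUnit_of_abs_le (abs_le.2 ⟨h, h'⟩),
      clampUnit_of_abs_le (by rwa [abs_neg, abs_le, and_iff_right h])]

theorem abs_clampUnit_sub_le (x y : ℝ) : |clampUnit x - clampUnit y| ≤ |x - y| :=
  Set.abs_projIcc_sub_projIcc _

theorem clampUnit_sub_sq_le {c : ℝ} (hc : |c| ≤ 1) (y : ℝ) :
    (clampUnit y - c) ^ 2 ≤ (y - c) ^ 2 := by
  simpa only [clampUnit_of_abs_le hc] using sq_le_sq.2 (abs_clampUnit_sub_le y c)

theorem abs_clampUnit_sub_self_le {c : ℝ} (hc : |c| ≤ 1) (y : ℝ) :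
    |clampUnit y - y| ≤ |c - y| := by
  obtain ⟨hc₁, hc₂⟩ := abs_le.1 hc
  rcases le_total y (-1) with hleft | hleft
  · rw [clampUnit_of_le_neg_one hleft]
    exact abs_le_abs_of_nonneg (by linarith) (by linarith)
  rcases le_total 1 y with hright | hright
  · rw [clampUnit_of_one_le hright]
    exact abs_le_abs_of_nonpos (by linarith) (by linarith)
  · simp [clampUnit_of_abs_le (abs_le.2 ⟨hleft, hright⟩)]

/-- Beyond `±1`, the left-hand side is the minimum `-1` of the cosine. -/
theorem cos_pi_mul_clampUnit_le (y : ℝ) :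
    Real.cos (Real.pi * clampUnit y) ≤ Real.cos (Real.pi * y) := by
  rcases le_total y (-1) with h | h
  · simpa [clampUnit_of_le_neg_one h] using Real.neg_one_le_cos (Real.pi * y)
  rcases le_total 1 y with h' | h'
  · simpa [clampUnit_of_one_le h'] using Real.neg_one_le_cos (Real.pi * y)
  · rw [clampUnit_of_abs_le (abs_le.2 ⟨h, h'⟩)]

theorem quarter_sub_cos_div_pi_le_sq {y : ℝ} (hy : |y| ≤ 1) :
    1 / 4 - Real.cos (Real.pi * y) / Real.pi ≤ y ^ 2 := by
  wlog h : 0 ≤ y generalizing y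
  · simpa using this (y := -y) (by simpa using hy) (by linarith)
  have hcos : Real.cos (Real.pi * y) = Real.sin (Real.pi * (1 / 2 - y)) := by
    rw [← Real.sin_pi_div_two_sub]
    congr 1
    ring
  suffices Real.pi * (1 / 4 - y ^ 2) ≤ Real.sin (Real.pi * (1 / 2 - y)) by
    rw [hcos, sub_le_iff_le_add', ← sub_le_iff_le_add, le_div_iff₀' Real.pi_pos]
    exact this
  have hpi : 3 < Real.pi := Real.pi_gt_three
  have hpi' : Real.pi < 3.15 := Real.pi_lt_d2
  rcases le_total y (1 / 2) with hhalf | hhalf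
  · have hsin := Real.sin_ge_sub_cube (x := Real.pi * (1 / 2 - y)) (by nlinarith)
    have hcube : 0 ≤ Real.pi * (1 / 2 - y) ^ 2 * (6 - Real.pi ^ 2 * (1 / 2 - y)) := by
      have hsmall : 0 ≤ 6 - Real.pi ^ 2 * (1 / 2 - y) := by nlinarith
      positivity
    linarith
  · have hsin := Real.sin_le (x := Real.pi * (y - 1 / 2)) (by nlinarith)
    rw [← neg_sub y, mul_neg, Real.sin_neg]
    nlinarith [mul_nonneg Real.pi_pos.le (sq_nonneg (y - 1 / 2))]

/-- The walk on `[-1, 1]` started from `0` that adds the increments `ξ 0, ξ 1, …` one by one and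
projects back onto `[-1, 1]` after each step. -/
noncomputable def clampedWalk (ξ : ℕ → ℝ) : ℕ → ℝ
  | 0 => 0
  | t + 1 => clampUnit (clampedWalk ξ t + ξ t)

section clampedWalk

variable {ξ ξ' : ℕ → ℝ} {t : ℕ}

theorem abs_clampedWalk_le (ξ : ℕ → ℝ) (t : ℕ) : |clampedWalk ξ t| ≤ 1 := by
  cases t with
  | zero => simp [clampedWalk]
  | succ t => exact abs_clampUnit_le _

theorem abs_clampedWalk_sub_le (ξ ξ' : ℕ → ℝ) (t : ℕ) :
    |clampedWalk ξ t - clampedWalk ξ' t| ≤ ∑ i ∈ Finset.range t, |ξ i - ξ' i| := by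
  induction t with
  | zero => simp [clampedWalk]
  | succ t ih =>
    calc |clampedWalk ξ (t + 1) - clampedWalk ξ' (t + 1)|
        ≤ |(clampedWalk ξ t + ξ t) - (clampedWalk ξ' t + ξ' t)| := abs_clampUnit_sub_le _ _
      _ ≤ |clampedWalk ξ t - clampedWalk ξ' t| + |ξ t - ξ' t| := by
        rw [add_sub_add_comm]
        exact abs_add_le _ _
      _ ≤ _ := by
        rw [Finset.sum_range_succ]
        gcongr

theorem clampedWalk_congr (h : ∀ i < t, ξ i = ξ' i) : clampedWalk ξ t = clampedWalk ξ' t := by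
  have hsum : ∑ i ∈ Finset.range t, |ξ i - ξ' i| = 0 :=
    Finset.sum_eq_zero fun i hi => by simp [h i (Finset.mem_range.1 hi)]
  exact sub_eq_zero.1 (abs_nonpos_iff.1 ((abs_clampedWalk_sub_le ξ ξ' t).trans_eq hsum))

end clampedWalk

/-- The clamped walk with random increments `±a 0, …, ±a (n - 1)`, the signs being those of the
bits `b`, and no further steps after time `n`. -/
noncomputable def signWalk (a : ℕ → ℝ) {n : ℕ} (b : Fin n → Bool) : ℕ → ℝ :=
  clampedWalk fun t => if h : t < n then a t * bitSign (b ⟨t, h⟩) else 0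

section signWalk

variable (a : ℕ → ℝ) {n : ℕ} {s t : ℕ}

theorem signWalk_update_of_le {i : Fin n} (hti : t ≤ i) (b : Fin n → Bool) (c : Bool) :
    signWalk a (Function.update b i c) t = signWalk a b t :=
  clampedWalk_congr fun j hj => by
    congr! 3 with hjn
    have hne : (⟨j, hjn⟩ : Fin n) ≠ i := Fin.ne_of_val_ne (hj.trans_le hti).ne
    exact Function.update_of_ne hne c b

theorem signWalk_succ_update_self (i : Fin n) (b : Fin n → Bool) (c : Bool) :
    signWalk a (Function.update b i c) (i + 1) =
      clampUnit (signWalk a b i + a i * bitSign c) := by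
  rw [← signWalk_update_of_le a le_rfl b c]
  simp [signWalk, clampedWalk]

theorem integral_signWalk_succ (hst : s ≤ t) (ht : t < n) (Φ : ℝ → ℝ → ℝ) :
    ∫ b, Φ (signWalk a b s) (signWalk a b (t + 1)) ∂fairBits (Fin n) =
      ∫ b, (Φ (signWalk a b s) (clampUnit (signWalk a b t + a t)) +
        Φ (signWalk a b s) (clampUnit (signWalk a b t - a t))) / 2 ∂fairBits (Fin n) := by
  rw [integral_fairBits_eq_integral_update ⟨t, ht⟩]
  congr 1 with b
  have hs (c : Bool) : signWalk a (Function.update b ⟨t, ht⟩ c) s = signWalk a b s :=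
    signWalk_update_of_le a hst b c
  have ht' (c : Bool) : signWalk a (Function.update b ⟨t, ht⟩ c) (t + 1) =
      clampUnit (signWalk a b t + a t * bitSign c) := signWalk_succ_update_self a ⟨t, ht⟩ b c
  simp [hs, ht', bitSign, sub_eq_add_neg]

theorem integral_cos_signWalk_succ_le (ht : t < n) :
    ∫ b, Real.cos (Real.pi * signWalk a b (t + 1)) ∂fairBits (Fin n) ≤
      Real.cos (Real.pi * a t) * ∫ b, Real.cos (Real.pi * signWalk a b t) ∂fairBits (Fin n) := by
  rw [integral_signWalk_succ a le_rfl ht fun _ y => Real.cos (Real.pi * y), ← integral_const_mul]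
  refine integral_mono .of_finite .of_finite fun b => ?_
  have hadd := cos_pi_mul_clampUnit_le (signWalk a b t + a t)
  have hsub := cos_pi_mul_clampUnit_le (signWalk a b t - a t)
  rw [mul_add, Real.cos_add] at hadd
  rw [mul_sub, Real.cos_sub] at hsub
  linarith

theorem integral_signWalk_sub_sq_le (hst : s ≤ t) (ht : t ≤ n) :
    ∫ b, (signWalk a b t - signWalk a b s) ^ 2 ∂fairBits (Fin n) ≤
      ∑ i ∈ Finset.Ico s t, a i ^ 2 := by
  induction t, hst using Nat.le_induction with
  | base => simp
  | succ t hst ih =>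
    calc ∫ b, (signWalk a b (t + 1) - signWalk a b s) ^ 2 ∂fairBits (Fin n)
        = ∫ b, ((clampUnit (signWalk a b t + a t) - signWalk a b s) ^ 2 +
            (clampUnit (signWalk a b t - a t) - signWalk a b s) ^ 2) / 2 ∂fairBits (Fin n) :=
          integral_signWalk_succ a hst ht fun x y => (y - x) ^ 2
      _ ≤ ∫ b, ((signWalk a b t - signWalk a b s) ^ 2 + a t ^ 2) ∂fairBits (Fin n) := by
          refine integral_mono .of_finite .of_finite fun b => ?_
          have hs : |signWalk a b s| ≤ 1 := abs_clampedWalk_le _ s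
          have hadd := clampUnit_sub_sq_le hs (signWalk a b t + a t)
          have hsub := clampUnit_sub_sq_le hs (signWalk a b t - a t)
          linarith
      _ ≤ ∑ i ∈ Finset.Ico s (t + 1), a i ^ 2 := by
          rw [integral_add .of_finite .of_finite, integral_const, probReal_univ, one_smul,
            Finset.sum_Ico_succ_top hst]
          gcongr
          exact ih (by omega)

/-- The average of `y ↦ h (clampUnit (y ± c))` over the two signs is again odd and monotone, so the
claim propagates from one time to the next. -/
theorem integral_mul_signWalk_nonneg_of_odd_of_monotone {h : ℝ → ℝ} (hodd : ∀ y, h (-y) = -h y)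
    (hmono : Monotone h) (hst : s ≤ t) (ht : t ≤ n) :
    0 ≤ ∫ b, signWalk a b s * h (signWalk a b t) ∂fairBits (Fin n) := by
  induction t, hst using Nat.le_induction generalizing h with
  | base =>
    have h0 : h 0 = 0 := by linarith [hodd 0, congrArg h (neg_zero (G := ℝ))]
    refine integral_nonneg fun b => ?_
    rcases le_total 0 (signWalk a b s) with hy | hy
    · exact mul_nonneg hy (h0 ▸ hmono hy)
    · exact mul_nonneg_of_nonpos_of_nonpos hy (h0 ▸ hmono hy)
  | succ t hst ih =>
    set h' : ℝ → ℝ := fun y => (h (clampUnit (y + a t)) + h (clampUnit (y - a t))) / 2 with hh'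
    have hodd' (y : ℝ) : h' (-y) = -h' y := by
      have hadd : -y + a t = -(y - a t) := by ring
      have hsub : -y - a t = -(y + a t) := by ring
      simp only [hh', hadd, hsub, clampUnit_neg, hodd]
      ring
    have hmono' : Monotone h' := fun x y hxy => by
      have hadd := hmono (monotone_clampUnit (add_le_add_left hxy (a t)))
      have hsub := hmono (monotone_clampUnit (sub_le_sub_right hxy (a t)))
      simp only [hh']
      linarith
    refine (ih hodd' hmono' (by omega)).trans_eq ?_
    rw [integral_signWalk_succ a hst ht fun x y => x * h y]
    congr 1 with b
    simp only [hh']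
    ring

end signWalk

theorem sum_sum_Ico_one_div_le {m j : ℕ} (h : m ≤ j) :
    ∑ t ∈ Finset.Ico m j, ∑ i ∈ Finset.Ico t j, 1 / ((i : ℝ) + 1) ≤
      (j - m) * (j - m + 1) / (m + j + 1) := by
  obtain ⟨N, rfl⟩ := Nat.exists_eq_add_of_le h
  suffices ∑ t ∈ Finset.Ico m (m + N), ∑ i ∈ Finset.Ico t (m + N), 1 / ((i : ℝ) + 1) ≤
      (N : ℝ) * (N + 1) / (2 * m + N + 1) by
    refine this.trans_eq ?_
    push_cast
    ring_nf
  clear h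
  induction N with
  | zero => simp
  | succ N ih =>
    have hsum : ∑ t ∈ Finset.Ico m (m + N + 1), ∑ i ∈ Finset.Ico t (m + N + 1),
        1 / ((i : ℝ) + 1) = ∑ t ∈ Finset.Ico m (m + N), ∑ i ∈ Finset.Ico t (m + N),
          1 / ((i : ℝ) + 1) + (N + 1) * (1 / ((m : ℝ) + N + 1)) := by
      rw [Finset.sum_Ico_succ_top (by omega), Finset.sum_congr rfl fun t ht =>
        Finset.sum_Ico_succ_top (Finset.mem_Ico.1 ht).2.le _, Finset.sum_add_distrib]
      simp
      ring
    have hgap : ((N : ℝ) + 1) * (N + 1 + 1) / (2 * m + (N + 1) + 1) -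
        (N * (N + 1) / (2 * m + N + 1) + (N + 1) * (1 / (m + N + 1))) =
        (N + 1) * N * m / ((2 * m + N + 2) * (2 * m + N + 1) * (m + N + 1)) := by
      field_simp
      ring
    have hgap_nonneg : 0 ≤ ((N : ℝ) + 1) * N * m /
        ((2 * m + N + 2) * (2 * m + N + 1) * (m + N + 1)) := by positivity
    rw [← add_assoc, hsum]
    push_cast
    linarith

section InverseSqrtSteps

variable {a : ℕ → ℝ} {n t j : ℕ}

/-- For steps of size `1 / √(i + 1)`, the bound on the expected cosine vanishes at time `4`, when
the last step size is `1 / 2`, and stays nonpositive under the shorter steps that follow. -/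
theorem integral_cos_signWalk_nonpos (ha : ∀ i, a i ^ 2 = 1 / ((i : ℝ) + 1)) (h4 : 4 ≤ t)
    (ht : t ≤ n) : ∫ b, Real.cos (Real.pi * signWalk a b t) ∂fairBits (Fin n) ≤ 0 := by
  induction t, h4 using Nat.le_induction with
  | base =>
    have hcos : Real.cos (Real.pi * a 3) = 0 := by
      have habs : |a 3| = 1 / 2 := by
        rw [← Real.sqrt_sq_eq_abs, ha, Real.sqrt_eq_iff_mul_self_eq] <;> norm_num
      rw [← Real.cos_abs, abs_mul, abs_of_pos Real.pi_pos, habs, mul_one_div, Real.cos_pi_div_two]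
    simpa [hcos] using integral_cos_signWalk_succ_le a (by omega : 3 < n)
  | succ t h4 ih =>
    have habs : |a t| ≤ 1 / 2 := by
      refine abs_le_of_sq_le_sq ?_ (by norm_num)
      have ht4 : (4 : ℝ) ≤ t := by exact_mod_cast h4
      rw [ha, div_le_iff₀ (by positivity)]
      linarith
    have hcos : 0 ≤ Real.cos (Real.pi * a t) := by
      rw [abs_le] at habs
      apply Real.cos_nonneg_of_neg_pi_div_two_le_of_le <;> nlinarith [Real.pi_pos]
    exact (integral_cos_signWalk_succ_le a (by omega)).trans
      (mul_nonpos_of_nonneg_of_nonpos hcos (ih (by omega)))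

theorem quarter_le_integral_signWalk_sq (ha : ∀ i, a i ^ 2 = 1 / ((i : ℝ) + 1)) (h4 : 4 ≤ t)
    (ht : t ≤ n) : 1 / 4 ≤ ∫ b, signWalk a b t ^ 2 ∂fairBits (Fin n) := by
  calc (1 : ℝ) / 4
      ≤ 1 / 4 - (∫ b, Real.cos (Real.pi * signWalk a b t) ∂fairBits (Fin n)) / Real.pi :=
        le_sub_self_iff _ |>.2 (div_nonpos_of_nonpos_of_nonneg
          (integral_cos_signWalk_nonpos ha h4 ht) Real.pi_pos.le)
    _ = ∫ b, (1 / 4 - Real.cos (Real.pi * signWalk a b t) / Real.pi) ∂fairBits (Fin n) := by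
        rw [integral_sub .of_finite .of_finite, integral_const, integral_div]
        simp
    _ ≤ _ := integral_mono .of_finite .of_finite fun b =>
        quarter_sub_cos_div_pi_le_sq (abs_clampedWalk_le _ t)

theorem quarter_sub_le_integral_signWalk_mul_signWalk (ha : ∀ i, a i ^ 2 = 1 / ((i : ℝ) + 1))
    (h4 : 4 ≤ t) (htj : t ≤ j) (hj : j ≤ n) :
    1 / 4 - 1 / 2 * ∑ i ∈ Finset.Ico t j, 1 / ((i : ℝ) + 1) ≤
      ∫ b, signWalk a b t * signWalk a b j ∂fairBits (Fin n) := by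
  have hdiff := integral_signWalk_sub_sq_le a htj hj
  simp only [ha] at hdiff
  have hexpand : ∫ b, (signWalk a b j - signWalk a b t) ^ 2 ∂fairBits (Fin n) =
      ∫ b, signWalk a b j ^ 2 ∂fairBits (Fin n) + ∫ b, signWalk a b t ^ 2 ∂fairBits (Fin n) -
        2 * ∫ b, signWalk a b t * signWalk a b j ∂fairBits (Fin n) := by
    rw [← integral_const_mul, ← integral_add .of_finite .of_finite,
      ← integral_sub .of_finite .of_finite]
    congr 1 with b
    ring
  have ht4 := quarter_le_integral_signWalk_sq ha h4 (htj.trans hj)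
  have hj4 := quarter_le_integral_signWalk_sq ha (h4.trans htj) hj
  linarith

/-- The last `N ≈ 2j/5` terms already give the bound. -/
theorem le_sum_integral_signWalk_mul_signWalk (ha : ∀ i, a i ^ 2 = 1 / ((i : ℝ) + 1))
    (hj : j ≤ n) :
    ((j : ℝ) - 5) / 20 ≤
      ∑ t ∈ Finset.range j, ∫ b, signWalk a b t * signWalk a b j ∂fairBits (Fin n) := by
  have hnonneg : ∀ t ∈ Finset.range j,
      0 ≤ ∫ b, signWalk a b t * signWalk a b j ∂fairBits (Fin n) := fun t ht =>
    integral_mul_signWalk_nonneg_of_odd_of_monotone a (h := id) (fun _ => rfl) monotone_id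
      (Finset.mem_range.1 ht).le hj
  rcases Nat.lt_or_ge j 6 with h6 | h6
  · have hj5 : (j : ℝ) ≤ 5 := by exact_mod_cast (by omega : j ≤ 5)
    exact (by linarith : ((j : ℝ) - 5) / 20 ≤ 0).trans (Finset.sum_nonneg hnonneg)
  obtain ⟨N, m, rfl, hN, hN'⟩ : ∃ N m, j = m + N ∧ 5 * N ≤ 2 * j ∧ 2 * j ≤ 5 * N + 4 :=
    ⟨2 * j / 5, j - 2 * j / 5, by omega, by omega, by omega⟩
  have hNm : 3 * (N : ℝ) ≤ 2 * m := by exact_mod_cast (by omega : 3 * N ≤ 2 * m)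
  have hmN : 2 * (m : ℝ) ≤ 3 * N + 4 := by exact_mod_cast (by omega : 2 * m ≤ 3 * N + 4)
  have hblock : ∑ t ∈ Finset.Ico m (m + N), ∑ i ∈ Finset.Ico t (m + N), 1 / ((i : ℝ) + 1) ≤
      N / 4 + 3 / 10 := by
    refine (sum_sum_Ico_one_div_le (by omega)).trans ?_
    rw [div_le_iff₀ (by positivity)]
    push_cast
    nlinarith
  calc (((m + N : ℕ) : ℝ) - 5) / 20
      ≤ ∑ t ∈ Finset.Ico m (m + N),
          (1 / 4 - 1 / 2 * ∑ i ∈ Finset.Ico t (m + N), 1 / ((i : ℝ) + 1)) := by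
        rw [Finset.sum_sub_distrib, ← Finset.mul_sum]
        simp only [Finset.sum_const, Nat.card_Ico, nsmul_eq_mul, Nat.add_sub_cancel_left]
        push_cast
        linarith
    _ ≤ ∑ t ∈ Finset.Ico m (m + N),
          ∫ b, signWalk a b t * signWalk a b (m + N) ∂fairBits (Fin n) :=
        Finset.sum_le_sum fun t ht => by
          rw [Finset.mem_Ico] at ht
          exact quarter_sub_le_integral_signWalk_mul_signWalk ha (by omega) ht.2.le hj
    _ ≤ _ := by
        rw [Finset.range_eq_Ico]
        refine Finset.sum_le_sum_of_subset_of_nonneg (Finset.Ico_subset_Ico_left (by omega)) ?_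
        exact fun t ht _ => hnonneg t (by simpa using ht)

theorem le_integral_sum_signWalk_sq (ha : ∀ i, a i ^ 2 = 1 / ((i : ℝ) + 1)) {k : ℕ}
    (hk : k ≤ n + 1) :
    (k : ℝ) ^ 2 / 20 - 11 / 20 * k ≤
      ∫ b, (∑ t ∈ Finset.range k, signWalk a b t) ^ 2 ∂fairBits (Fin n) := by
  induction k with
  | zero => simp
  | succ k ih =>
    have hcross := le_sum_integral_signWalk_mul_signWalk ha (by omega : k ≤ n)
    calc ((k + 1 : ℕ) : ℝ) ^ 2 / 20 - 11 / 20 * (k + 1 : ℕ)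
        ≤ ∫ b, (∑ t ∈ Finset.range k, signWalk a b t) ^ 2 ∂fairBits (Fin n) +
          2 * ∑ t ∈ Finset.range k, ∫ b, signWalk a b t * signWalk a b k ∂fairBits (Fin n) := by
          push_cast
          linarith [ih (by omega)]
      _ = ∫ b, ((∑ t ∈ Finset.range k, signWalk a b t) ^ 2 +
            2 * ∑ t ∈ Finset.range k, signWalk a b t * signWalk a b k) ∂fairBits (Fin n) := by
          rw [← integral_finsetSum _ fun _ _ => .of_finite, ← integral_const_mul,
            ← integral_add .of_finite .of_finite]
      _ ≤ _ := integral_mono .of_finite .of_finite fun b => by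
          rw [Finset.sum_range_succ, ← Finset.sum_mul]
          linarith [sq_nonneg (signWalk a b k)]

/-- The bound comes from `𝔼 Y² ≥ 1 / 20 - 11 / (20 n)` and `Y² ≤ 1` for the time average `Y`. -/
theorem le_measureReal_abs_mean_signWalk (ha : ∀ i, a i ^ 2 = 1 / ((i : ℝ) + 1)) (hn : 3000 ≤ n) :
    117 / 10000 ≤ (fairBits (Fin n)).real
      {b | 39 / 200 ≤ |1 / (n : ℝ) * ∑ t ∈ Finset.range n, signWalk a b t|} := by
  have hn' : (3000 : ℝ) ≤ n := by exact_mod_cast hn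
  have hle (b : Fin n → Bool) : (1 / (n : ℝ) * ∑ t ∈ Finset.range n, signWalk a b t) ^ 2 ≤ 1 := by
    rw [sq_le_one_iff_abs_le_one, abs_mul, abs_of_nonneg (by positivity), one_div_mul_eq_div,
      div_le_one (by linarith)]
    calc |∑ t ∈ Finset.range n, signWalk a b t| ≤ ∑ t ∈ Finset.range n, |signWalk a b t| :=
          Finset.abs_sum_le_sum_abs _ _
      _ ≤ ∑ _t ∈ Finset.range n, 1 := Finset.sum_le_sum fun t _ => abs_clampedWalk_le _ t
      _ = n := by simp
  have hmoment : 1 / 20 - 11 / 20 * (1 / (n : ℝ)) ≤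
      ∫ b, (1 / (n : ℝ) * ∑ t ∈ Finset.range n, signWalk a b t) ^ 2 ∂fairBits (Fin n) := by
    calc 1 / 20 - 11 / 20 * (1 / (n : ℝ))
        = (1 / (n : ℝ)) ^ 2 * ((n : ℝ) ^ 2 / 20 - 11 / 20 * n) := by field_simp
      _ ≤ _ := by
        simp only [mul_pow, integral_const_mul]
        gcongr
        exact le_integral_sum_signWalk_sq ha (by omega)
  have hmass := integral_sub_le_measureReal_of_le_one (μ := fairBits (Fin n)) .of_finite
    (ae_of_all _ hle) (sq_nonneg (39 / 200))
  have hinv : 1 / (n : ℝ) ≤ 1 / 3000 := one_div_le_one_div_of_le (by norm_num) hn'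
  simp only [sq_le_sq, abs_of_pos (by norm_num : (0 : ℝ) < 39 / 200)] at hmass
  linarith

end InverseSqrtSteps

/-- The time average of the clamped walk with steps `∓1 / √t`, which is the output of adaptive SGD
with learning rate `1` on the linear losses `± x` on the real line. -/
noncomputable def meanInvSqrtWalk {n : ℕ} (b : Fin n → Bool) : ℝ :=
  1 / (n : ℝ) * ∑ t ∈ Finset.range n, signWalk (fun i => -(1 / √((i : ℝ) + 1))) b t

/-- The training bits drive the averaged walk away from the origin, and the sum of the validation
signs is of the order of its standard deviation `√n`, with the opposite sign. -/
def IsMisleading {n : ℕ} (train valid : Fin n → Bool) : Prop :=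
  39 / 200 ≤ |meanInvSqrtWalk train| ∧ √(n : ℝ) / 20 ≤ |∑ i, bitSign (valid i)| ∧
    meanInvSqrtWalk train * ∑ i, bitSign (valid i) < 0

section IsMisleading

variable {Ω : Type*} [MeasurableSpace Ω] {μ : Measure Ω} [IsProbabilityMeasure μ] {n : ℕ}

theorem le_measureReal_sqrt_le_abs_sum_bitSign (n : ℕ) :
    (1 - 1 / 400) ^ 2 / 3 ≤
      (fairBits (Fin n)).real {b | √(n : ℝ) / 20 ≤ |∑ i, bitSign (b i)|} := by
  refine (one_sub_sq_div_three_le_measureReal_sum_mul_bitSign_sq (ι := Fin n) (fun _ => 1)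
    (by norm_num) (by norm_num)).trans_eq ?_
  congr 1 with b
  have hsq : (√(n : ℝ) / 20) ^ 2 = 1 / 400 * n := by
    rw [div_pow, Real.sq_sqrt n.cast_nonneg]
    ring
  rw [Set.mem_ofPred_eq, Set.mem_ofPred_eq, ← abs_of_nonneg (by positivity : 0 ≤ √(n : ℝ) / 20),
    ← sq_le_sq, hsq]
  simp

theorem le_measureReal_isMisleading (hn : 3000 ≤ n) {T U : Ω → Fin n → Bool}
    (hT : HasLaw T (fairBits (Fin n)) μ) (hU : HasLaw U (fairBits (Fin n)) μ)
    (hTU : IndepFun T U μ) : 1 / 1000 ≤ μ.real {ω | IsMisleading (T ω) (U ω)} := by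
  set signSum : (Fin n → Bool) → ℝ := fun b => ∑ i, bitSign (b i) with hsum
  have hYV : IndepFun (meanInvSqrtWalk ∘ T) (signSum ∘ U) μ :=
    hTU.comp (measurable_of_finite _) (measurable_of_finite _)
  have hY : AEMeasurable (meanInvSqrtWalk ∘ T) μ :=
    (measurable_of_finite meanInvSqrtWalk).comp_aemeasurable hT.aemeasurable
  have hV : IdentDistrib (signSum ∘ U) (-(signSum ∘ U)) μ μ := by
    have hflip := hU.identDistrib (measurePreserving_not_fairBits.hasLaw.comp hU)
    convert hflip.comp (measurable_of_finite signSum) using 1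
    ext ω
    simp [hsum, bitSign_not]
  have hYlarge : 117 / 10000 ≤ μ.real {ω | 39 / 200 ≤ |(meanInvSqrtWalk ∘ T) ω|} := by
    rw [Function.comp_def, hT.measureReal_eq (p := fun b => 39 / 200 ≤ |meanInvSqrtWalk b|)
      (Set.toFinite _).measurableSet]
    refine le_measureReal_abs_mean_signWalk (fun i => ?_) hn
    rw [neg_sq, div_pow, one_pow, Real.sq_sqrt (by positivity)]
  have hVlarge : (1 - 1 / 400) ^ 2 / 3 ≤ μ.real {ω | √(n : ℝ) / 20 ≤ |(signSum ∘ U) ω|} := by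
    rw [Function.comp_def, hU.measureReal_eq (p := fun b => √(n : ℝ) / 20 ≤ |signSum b|)
      (Set.toFinite _).measurableSet]
    exact le_measureReal_sqrt_le_abs_sum_bitSign n
  calc (1 : ℝ) / 1000 ≤ 1 / 2 * (117 / 10000 * ((1 - 1 / 400) ^ 2 / 3)) := by norm_num
    _ ≤ 1 / 2 * (μ.real {ω | 39 / 200 ≤ |(meanInvSqrtWalk ∘ T) ω|} *
          μ.real {ω | √(n : ℝ) / 20 ≤ |(signSum ∘ U) ω|}) := by gcongr
    _ = _ := (measureReal_mul_neg_of_indepFun_of_symmetric hYV hY hV (by norm_num)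
        (by positivity)).symm

theorem withProbAtLeast_isMisleading (hn : 3000 ≤ n) {S : ℕ → Ω → Bool}
    (hlaw : ∀ i ∈ Finset.Icc 1 (2 * n), HasLaw (S i) fairBit μ)
    (hindep : iIndepFun (fun i : Finset.Icc 1 (2 * n) => S i) μ) :
    WithProbAtLeast μ (1 / 1000) fun ω =>
      IsMisleading (fun i : Fin n => S (n + (i + 1)) ω) (fun i : Fin n => S (i + 1) ω) := by
  let f : Fin n → Finset.Icc 1 (2 * n) := fun i => ⟨n + (i + 1), by simp; omega⟩
  let g : Fin n → Finset.Icc 1 (2 * n) := fun i => ⟨i + 1, by simp; omega⟩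
  have hf : f.Injective := fun i j h => by simpa [f, Fin.ext_iff] using h
  have hg : g.Injective := fun i j h => by simpa [g, Fin.ext_iff] using h
  have hfg : Disjoint (Set.range f) (Set.range g) := by
    rw [Set.disjoint_range_iff]
    intro i j
    simp only [f, g, ne_eq, Subtype.mk.injEq]
    omega
  have hT : HasLaw (fun ω i => S (f i) ω) (fairBits (Fin n)) μ :=
    iIndepFun.hasLaw_pi (fun i => hlaw _ (f i).2) (hindep.precomp hf)
  have hU : HasLaw (fun ω i => S (g i) ω) (fairBits (Fin n)) μ :=
    iIndepFun.hasLaw_pi (fun i => hlaw _ (g i).2) (hindep.precomp hg)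
  have hTU : IndepFun (fun ω i => S (f i) ω) (fun ω i => S (g i) ω) μ :=
    indepFun_tuples_of_disjoint_range hindep (fun i => (hlaw i i.2).aemeasurable) hfg
  have hmeas : NullMeasurableSet
      {ω | IsMisleading (fun i : Fin n => S (n + (i + 1)) ω) (fun i : Fin n => S (i + 1) ω)} μ :=
    (hT.aemeasurable.prodMk hU.aemeasurable).nullMeasurableSet_preimage
      (s := {p : (Fin n → Bool) × (Fin n → Bool) | IsMisleading p.1 p.2}) .of_discrete
  exact withProbAtLeast_of_nullMeasurableSet hmeas (le_measureReal_isMisleading hn hT hU hTU)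

end IsMisleading

theorem projBall_smul {d : ℕ} {X : Set (EuclideanSpace ℝ (Fin d))} (hX : IsClosed X)
    (hconv : Convex ℝ X) (h0 : 0 ∈ X) (hcone : ∀ c : ℝ, 0 ≤ c → ∀ x ∈ X, c • x ∈ X)
    {c R : ℝ} (hc : 0 < c) (hR : 0 ≤ R) (v : EuclideanSpace ℝ (Fin d)) :
    projBall X (c * R) (c • v) = c • projBall X R v := by
  obtain ⟨⟨hmem, hnorm⟩, hmin⟩ := projBall_mem hX h0 hR v
  refine (eq_projBall_of_mem hX hconv h0 (by positivity)
    ⟨⟨hcone c hc.le _ hmem, ?_⟩, fun w hw hwR => ?_⟩).symm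
  · rw [norm_smul, Real.norm_of_nonneg hc.le]
    gcongr
  · have hle := hmin (c⁻¹ • w) (hcone _ (by positivity) w hw) (by
      rwa [norm_smul, Real.norm_of_nonneg (by positivity), inv_mul_le_iff₀ hc])
    calc ‖c • projBall X R v - c • v‖ = c * ‖projBall X R v - v‖ := by
          rw [← smul_sub, norm_smul, Real.norm_of_nonneg hc.le]
      _ ≤ c * ‖c⁻¹ • w - v‖ := by gcongr
      _ = ‖w - c • v‖ := by
          rw [← Real.norm_of_nonneg hc.le, ← norm_smul, smul_sub, Real.norm_of_nonneg hc.le,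
            smul_inv_smul₀ hc.ne']

theorem norm_euclideanSpace_fin_one (x : EuclideanSpace ℝ (Fin 1)) : ‖x‖ = |x 0| := by
  simp [EuclideanSpace.norm_eq, Real.sqrt_sq_eq_abs]

theorem projBall_univ_one_apply (v : EuclideanSpace ℝ (Fin 1)) :
    projBall Set.univ 1 v 0 = clampUnit (v 0) := by
  have hmem : (!₂[clampUnit (v 0)] : EuclideanSpace ℝ (Fin 1)) ∈ nearestPoints Set.univ 1 v := by
    refine ⟨⟨Set.mem_univ _, ?_⟩, fun w _ hw => ?_⟩
    · simpa [norm_euclideanSpace_fin_one] using abs_clampUnit_le (v 0)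
    · rw [norm_euclideanSpace_fin_one] at hw
      simpa [norm_euclideanSpace_fin_one] using abs_clampUnit_sub_self_le hw (v 0)
  rw [← eq_projBall_of_mem isClosed_univ convex_univ (Set.mem_univ _) zero_le_one hmem]
  rfl

namespace StochConvexProblem

section PosHomogeneous

variable {d : ℕ} {𝒮 : Type*} [MeasurableSpace 𝒮] {P : StochConvexProblem d 𝒮}
  {g : EuclideanSpace ℝ (Fin d) → 𝒮 → EuclideanSpace ℝ (Fin d)}

/-- The domain is a cone on which every loss is positively homogeneous, so that rescaling the model
rescales its population and validation losses. -/
structure IsPosHomogeneous (P : StochConvexProblem d 𝒮) : Prop where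
  smul_mem : ∀ c : ℝ, 0 ≤ c → ∀ x ∈ P.domain, c • x ∈ P.domain
  loss_smul : ∀ c : ℝ, 0 ≤ c → ∀ x ∈ P.domain, ∀ s, P.loss (c • x) s = c * P.loss x s

theorem adaSGDState_fst_mem (g : EuclideanSpace ℝ (Fin d) → 𝒮 → EuclideanSpace ℝ (Fin d))
    {R : ℝ} (hR : 0 ≤ R) (z : ℕ → 𝒮) (t : ℕ) : (P.adaSGDState g R z t).1 ∈ P.domain := by
  cases t with
  | zero => exact P.zero_mem
  | succ t => exact (projBall_mem P.isClosed_domain P.zero_mem hR _).1.1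

theorem adaSGD_eq_smul_sum_range (g : EuclideanSpace ℝ (Fin d) → 𝒮 → EuclideanSpace ℝ (Fin d))
    (R : ℝ) (n : ℕ) (z : ℕ → 𝒮) :
    P.adaSGD g R n z = (1 / (n : ℝ)) • ∑ t ∈ Finset.range n, (P.adaSGDState g R z t).1 := by
  rw [adaSGD, Finset.range_eq_Ico, ← Finset.Ico_add_one_right_eq_Icc,
    ← Finset.sum_Ico_add' _ 0 n 1]
  rfl

namespace IsPosHomogeneous

theorem empRisk_smul (hP : P.IsPosHomogeneous) {c : ℝ} (hc : 0 ≤ c) (n : ℕ) (z : ℕ → 𝒮)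
    {x : EuclideanSpace ℝ (Fin d)} (hx : x ∈ P.domain) :
    P.empRisk n z (c • x) = c * P.empRisk n z x := by
  simp only [empRisk, hP.loss_smul c hc x hx, ← Finset.mul_sum]
  ring

theorem le_of_mem_greedySelection_smul (hP : P.IsPosHomogeneous) {n : ℕ} {z : ℕ → 𝒮}
    {x : EuclideanSpace ℝ (Fin d)} (hx : x ∈ P.domain) (hneg : P.empRisk n z x < 0) {ι : Type*}
    {η : ι → ℝ} (hη : ∀ k, 0 < η k) {k : ι}
    (hk : k ∈ P.greedySelection n z fun k => η k • x) (j : ι) : η j ≤ η k := by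
  have hkj := hk j
  simp only [hP.empRisk_smul (hη _).le n z hx] at hkj
  exact (mul_le_mul_right_of_neg hneg).1 hkj

/-- Euler's identity. -/
theorem inner_eq_loss (hP : P.IsPosHomogeneous) {x v : EuclideanSpace ℝ (Fin d)} {s : 𝒮}
    (hx : x ∈ P.domain) (hv : P.IsSubgradient x s v) : inner ℝ v x = P.loss x s := by
  have h0 := hv _ (hP.smul_mem 0 le_rfl x hx)
  have h2 := hv _ (hP.smul_mem 2 zero_le_two x hx)
  have hsub : (2 : ℝ) • x - x = x := by module
  rw [hP.loss_smul 0 le_rfl x hx, zero_smul, zero_sub, inner_neg_right] at h0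
  rw [hP.loss_smul 2 zero_le_two x hx, hsub] at h2
  linarith

/-- By Euler's identity a one-dimensional subgradient at `x ≠ 0` is the slope of the loss there. -/
theorem subgradient_smul {P : StochConvexProblem 1 𝒮} (hP : P.IsPosHomogeneous)
    {g : EuclideanSpace ℝ (Fin 1) → 𝒮 → EuclideanSpace ℝ (Fin 1)} {s : 𝒮}
    (hg : ∀ x ∈ P.domain, P.IsSubgradient x s (g x s)) {c : ℝ} (hc : 0 < c)
    {x : EuclideanSpace ℝ (Fin 1)} (hx : x ∈ P.domain) : g (c • x) s = g x s := by
  rcases eq_or_ne x 0 with rfl | hne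
  · rw [smul_zero]
  have hcx := hP.smul_mem c hc.le x hx
  have heuler := hP.inner_eq_loss hcx (hg _ hcx)
  rw [hP.loss_smul c hc.le x hx, ← hP.inner_eq_loss hx (hg x hx), inner_smul_right] at heuler
  have hx0 : x 0 ≠ 0 := by simpa [PiLp.ext_iff] using hne
  ext i
  rw [Subsingleton.elim i 0]
  have hinner := mul_left_cancel₀ hc.ne' heuler
  simp only [PiLp.inner_apply, Fin.sum_univ_one, RCLike.inner_apply, conj_trivial] at hinner
  exact mul_left_cancel₀ hx0 hinner

theorem adaSGD_eq_smul (hP : P.IsPosHomogeneous)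
    (hg : ∀ c : ℝ, 0 < c → ∀ x ∈ P.domain, ∀ s, g (c • x) s = g x s) {R : ℝ} (hR : 0 < R) (n : ℕ)
    (z : ℕ → 𝒮) : P.adaSGD g R n z = R • P.adaSGD g 1 n z := by
  have hstate (t : ℕ) : P.adaSGDState g R z t =
      (R • (P.adaSGDState g 1 z t).1, (P.adaSGDState g 1 z t).2) := by
    induction t with
    | zero => simp [adaSGDState]
    | succ t ih =>
      have hproj := projBall_smul P.isClosed_domain P.convex_domain P.zero_mem hP.smul_mem hR
        zero_le_one
      rw [mul_one] at hproj
      simp only [adaSGDState, ih, hg R hR _ (adaSGDState_fst_mem g zero_le_one z t), ← hproj,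
        smul_sub, smul_smul, mul_one_div]
  simp only [adaSGD_eq_smul_sum_range, hstate, ← Finset.smul_sum]
  rw [smul_comm]

end IsPosHomogeneous

end PosHomogeneous

theorem mul_le_adaSGDState_snd {d : ℕ} {𝒮 : Type*} [MeasurableSpace 𝒮] {P : StochConvexProblem d 𝒮}
    {g : EuclideanSpace ℝ (Fin d) → 𝒮 → EuclideanSpace ℝ (Fin d)} {L : ℝ} (hL : 0 ≤ L)
    (hg : ∀ x s, L ≤ ‖g x s‖) (R : ℝ) (z : ℕ → 𝒮) (t : ℕ) :
    L ^ 2 * t ≤ (P.adaSGDState g R z t).2 := by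
  rw [adaSGDState_snd]
  refine (Finset.card_nsmul_le_sum _ _ _ fun j _ => pow_le_pow_left₀ hL (hg _ _) 2).trans' ?_
  simp [mul_comm]

theorem adaSGDState_snd_le_mul {d : ℕ} {𝒮 : Type*} [MeasurableSpace 𝒮] {P : StochConvexProblem d 𝒮}
    {g : EuclideanSpace ℝ (Fin d) → 𝒮 → EuclideanSpace ℝ (Fin d)} {L : ℝ}
    (hg : ∀ x s, ‖g x s‖ ≤ L) (R : ℝ) (z : ℕ → 𝒮) (t : ℕ) :
    (P.adaSGDState g R z t).2 ≤ L ^ 2 * t := by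
  rw [adaSGDState_snd]
  refine (Finset.sum_le_card_nsmul _ _ _ fun j _ =>
    pow_le_pow_left₀ (norm_nonneg _) (hg _ _) 2).trans_eq ?_
  simp [mul_comm]

theorem adaSGDState_one_apply_eq_clampedWalk {𝒮 : Type*} [MeasurableSpace 𝒮]
    {P : StochConvexProblem 1 𝒮} (hP : P.domain = Set.univ)
    (g : EuclideanSpace ℝ (Fin 1) → 𝒮 → EuclideanSpace ℝ (Fin 1)) (z : ℕ → 𝒮) (t : ℕ) :
    (P.adaSGDState g 1 z t).1 0 = clampedWalk (fun i =>
      -(g (P.adaSGDState g 1 z i).1 (z (i + 1)) 0 / √(P.adaSGDState g 1 z (i + 1)).2)) t := by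
  induction t with
  | zero => rfl
  | succ t ih =>
    rw [clampedWalk, ← ih]
    simp only [adaSGDState, hP, projBall_univ_one_apply, PiLp.sub_apply, PiLp.smul_apply,
      smul_eq_mul, one_div_mul_eq_div, ← sub_eq_add_neg]

end StochConvexProblem

theorem abs_div_sqrt_sub_one_div_sqrt_le {κ r G N : ℝ} (hκ : 0 < κ) (hr : κ ≤ r) (hr' : r ≤ 1)
    (hN : 0 < N) (hG : κ ^ 2 * N ≤ G) (hG' : G ≤ N) :
    |r / √G - 1 / √N| ≤ (1 / κ - 1) / √N := by
  have hsqrt : κ * √N ≤ √G := by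
    rw [← Real.sqrt_sq hκ.le, ← Real.sqrt_mul (sq_nonneg κ)]
    exact Real.sqrt_le_sqrt hG
  have hsqrtN : 0 < √N := Real.sqrt_pos.2 hN
  have hlower : κ / √N ≤ r / √G :=
    div_le_div₀ (hκ.le.trans hr) hr
      (hsqrt.trans_lt' (by positivity)) (Real.sqrt_le_sqrt hG')
  have hupper : r / √G ≤ 1 / κ / √N := by
    rw [div_div]
    exact div_le_div₀ zero_le_one hr' (by positivity) hsqrt
  have hamgm : 1 - κ ≤ 1 / κ - 1 := by
    rw [le_sub_iff_add_le, le_div_iff₀ hκ]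
    nlinarith [sq_nonneg (κ - 1)]
  rw [abs_le]
  constructor
  · have hle := div_le_div_of_nonneg_right hamgm hsqrtN.le
    rw [sub_div] at hle
    linarith
  · rw [sub_div]
    linarith

theorem sum_range_one_div_sqrt_le (n : ℕ) :
    ∑ i ∈ Finset.range n, 1 / √((i : ℝ) + 1) ≤ 2 * √(n : ℝ) := by
  induction n with
  | zero => simp
  | succ n ih =>
    have hn := Real.sq_sqrt (n.cast_nonneg (α := ℝ))
    have hn' := Real.sq_sqrt (by positivity : 0 ≤ (n : ℝ) + 1)
    have hstep : 1 / √((n : ℝ) + 1) ≤ 2 * √((n : ℝ) + 1) - 2 * √(n : ℝ) := by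
      rw [div_le_iff₀ (by positivity)]
      nlinarith [sq_nonneg (√((n : ℝ) + 1) - √(n : ℝ))]
    rw [Finset.sum_range_succ]
    push_cast
    linarith

theorem sum_range_sqrt_le (n : ℕ) : ∑ t ∈ Finset.range n, √(t : ℝ) ≤ 2 / 3 * (n * √(n : ℝ)) := by
  induction n with
  | zero => simp
  | succ n ih =>
    rw [Finset.sum_range_succ]
    push_cast
    have hn := Real.sq_sqrt (n.cast_nonneg (α := ℝ))
    have hn' := Real.sq_sqrt (by positivity : 0 ≤ (n : ℝ) + 1)
    have hp : 0 ≤ √(n : ℝ) := Real.sqrt_nonneg _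
    have hq : 0 ≤ √((n : ℝ) + 1) := Real.sqrt_nonneg _
    generalize √(n : ℝ) = p at *
    generalize √((n : ℝ) + 1) = q at *
    have hpq : (q - p) * (q + p) = 1 := by linarith
    have hcube : 2 * p ^ 3 + 3 * p * ((q - p) * (q + p)) ≤ 2 * q ^ 3 := by
      have hgap : 0 ≤ (q - p) ^ 2 * (2 * q + p) := by positivity
      linarith
    rw [hpq] at hcube
    rw [← hn] at ih
    rw [← hn']
    linarith

/-- Subgradients in `± [κ, 1]`, the sign being that of the sample, keep every step of adaptive SGD
within relative error `1 / κ - 1` of `∓ 1 / √t`. -/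
theorem abs_adaSGDState_sub_signWalk_le {P : StochConvexProblem 1 Bool} (hP : P.domain = Set.univ)
    {g : EuclideanSpace ℝ (Fin 1) → Bool → EuclideanSpace ℝ (Fin 1)} {κ : ℝ} (hκ : 0 < κ)
    (hg : ∀ x b, κ ≤ bitSign b * g x b 0 ∧ bitSign b * g x b 0 ≤ 1) (z : ℕ → Bool) {n t : ℕ}
    (ht : t ≤ n) :
    |(P.adaSGDState g 1 z t).1 0 -
        signWalk (fun i => -(1 / √((i : ℝ) + 1))) (fun i : Fin n => z (i + 1)) t| ≤
      (1 / κ - 1) * (2 * √(t : ℝ)) := by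
  have hnorm (x) (b) : ‖g x b‖ = bitSign b * g x b 0 := by
    rw [norm_euclideanSpace_fin_one, ← abs_of_nonneg (hκ.le.trans (hg x b).1), abs_mul, abs_bitSign,
      one_mul]
  have hκ1 : 1 ≤ 1 / κ := one_le_one_div hκ ((hg 0 true).1.trans (hg 0 true).2)
  rw [StochConvexProblem.adaSGDState_one_apply_eq_clampedWalk hP]
  refine (abs_clampedWalk_sub_le _ _ t).trans ?_
  calc _ ≤ ∑ i ∈ Finset.range t, (1 / κ - 1) * (1 / √((i : ℝ) + 1)) := by
        refine Finset.sum_le_sum fun i hi => ?_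
        rw [dif_pos ((Finset.mem_range.1 hi).trans_le ht)]
        set γ := g (P.adaSGDState g 1 z i).1 (z (i + 1))
        have hG := StochConvexProblem.mul_le_adaSGDState_snd (P := P) hκ.le
          (fun x b => (hg x b).1.trans_eq (hnorm x b).symm) 1 z (i + 1)
        have hG' := StochConvexProblem.adaSGDState_snd_le_mul (P := P)
          (fun x b => (hnorm x b).trans_le (hg x b).2) 1 z (i + 1)
        set G := (P.adaSGDState g 1 z (i + 1)).2
        push_cast at hG hG'
        rw [one_pow, one_mul] at hG'
        have hfactor : -(γ 0 / √G) - -(1 / √((i : ℝ) + 1)) * bitSign (z (i + 1)) =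
            -bitSign (z (i + 1)) * (bitSign (z (i + 1)) * γ 0 / √G - 1 / √((i : ℝ) + 1)) := by
          linear_combination (γ 0 / √G) * bitSign_sq (z (i + 1))
        rw [hfactor, abs_mul, abs_neg, abs_bitSign, one_mul, mul_one_div]
        exact abs_div_sqrt_sub_one_div_sqrt_le hκ (hg _ _).1 (hg _ _).2 (by positivity) hG hG'
    _ ≤ _ := by
        rw [← Finset.mul_sum]
        exact mul_le_mul_of_nonneg_left (sum_range_one_div_sqrt_le t) (sub_nonneg.2 hκ1)

theorem abs_adaSGD_sub_meanInvSqrtWalk_le {P : StochConvexProblem 1 Bool}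
    (hP : P.domain = Set.univ) {g : EuclideanSpace ℝ (Fin 1) → Bool → EuclideanSpace ℝ (Fin 1)}
    {κ : ℝ} (hκ : 0 < κ) (hg : ∀ x b, κ ≤ bitSign b * g x b 0 ∧ bitSign b * g x b 0 ≤ 1) (n : ℕ)
    (z : ℕ → Bool) :
    |P.adaSGD g 1 n z 0 - meanInvSqrtWalk fun i : Fin n => z (i + 1)| ≤
      4 / 3 * (1 / κ - 1) * √(n : ℝ) := by
  have hκ1 : 1 ≤ 1 / κ := one_le_one_div hκ ((hg 0 true).1.trans (hg 0 true).2)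
  rcases n.eq_zero_or_pos with rfl | hn
  · simp [StochConvexProblem.adaSGD, meanInvSqrtWalk]
  have hn' : (0 : ℝ) < n := by exact_mod_cast hn
  rw [StochConvexProblem.adaSGD_eq_smul_sum_range, meanInvSqrtWalk, PiLp.smul_apply, smul_eq_mul,
    WithLp.ofLp_sum, Finset.sum_apply, ← mul_sub, ← Finset.sum_sub_distrib, abs_mul,
    abs_of_pos (by positivity), one_div_mul_eq_div, div_le_iff₀ hn']
  calc _ ≤ ∑ t ∈ Finset.range n, (1 / κ - 1) * (2 * √(t : ℝ)) :=
        (Finset.abs_sum_le_sum_abs _ _).trans <| Finset.sum_le_sum fun t ht =>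
          abs_adaSGDState_sub_signWalk_le hP hκ hg z (Finset.mem_range.1 ht).le
    _ = (1 / κ - 1) * (2 * ∑ t ∈ Finset.range n, √(t : ℝ)) := by
        rw [← Finset.mul_sum, ← Finset.mul_sum]
    _ ≤ (1 / κ - 1) * (2 * (2 / 3 * (n * √(n : ℝ)))) := by
        gcongr
        exact sum_range_sqrt_le n
    _ = _ := by ring

theorem le_abs_and_mul_neg_of_abs_sub_le {a δ V w x : ℝ} (hw : a ≤ |w|) (hwV : w * V < 0)
    (hxw : |x - w| ≤ δ) (hδ : δ < a) : a - δ ≤ |x| ∧ x * V < 0 := by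
  wlog hw0 : 0 ≤ w generalizing w x V
  · have hneg := this (w := -w) (x := -x) (V := -V) (by rwa [abs_neg]) (by rwa [neg_mul_neg])
      (by rwa [neg_sub_neg, abs_sub_comm]) (by linarith)
    rwa [abs_neg, neg_mul_neg] at hneg
  rw [abs_of_nonneg hw0] at hw
  have hx : a - δ ≤ x := by linarith [(abs_le.1 hxw).1]
  exact ⟨hx.trans (le_abs_self x),
    mul_neg_of_pos_of_neg (by linarith) (neg_of_mul_neg_right hwV hw0)⟩

/-- The loss `f(x; ±) = ± (1 - ε) x + ε |x|` on the real line with a fair random sign. The risk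
`ε |x|` is `1 / ε` times flatter than the individual losses, so that selection among the models is
driven by the noise. -/
noncomputable def signProblem (ε : ℝ) (hε : 0 ≤ ε) : StochConvexProblem 1 Bool where
  domain := Set.univ
  isClosed_domain := isClosed_univ
  convex_domain := convex_univ
  zero_mem := Set.mem_univ _
  law := fairBit
  isProb := inferInstance
  loss x b := (1 - ε) * bitSign b * x 0 + ε * |x 0|
  convexOn_loss b := by
    have hlin : ConvexOn ℝ Set.univ
        fun x : EuclideanSpace ℝ (Fin 1) => (1 - ε) * bitSign b * x 0 :=
      (((1 - ε) * bitSign b) • (EuclideanSpace.proj (𝕜 := ℝ) (0 : Fin 1)).toLinearMap).convexOn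
        convex_univ
    have habs : ConvexOn ℝ Set.univ fun x : EuclideanSpace ℝ (Fin 1) => |x 0| :=
      (convexOn_norm convex_univ).congr fun x _ => norm_euclideanSpace_fin_one x
    exact hlin.add (habs.smul hε)
  integrable_loss _ _ := .of_finite
  bddBelow_risk := by
    refine ⟨0, ?_⟩
    rintro _ ⟨x, -, rfl⟩
    have hrisk : 0 ≤ ε * |x 0| := by positivity
    simp only [integral_fairBit, bitSign, if_true, Bool.false_eq_true, if_false]
    linarith

namespace signProblem

variable {ε : ℝ} {hε : 0 ≤ ε} {g : EuclideanSpace ℝ (Fin 1) → Bool → EuclideanSpace ℝ (Fin 1)}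

theorem risk_eq (x : EuclideanSpace ℝ (Fin 1)) : (signProblem ε hε).risk x = ε * |x 0| := by
  simp only [StochConvexProblem.risk, signProblem, integral_fairBit, bitSign, if_true,
    Bool.false_eq_true, if_false]
  ring

theorem isMinOn_risk : IsMinOn (signProblem ε hε).risk (signProblem ε hε).domain 0 := by
  intro x _
  simp only [Set.mem_ofPred_eq, risk_eq, PiLp.zero_apply, abs_zero, mul_zero]
  positivity

theorem optRisk_eq : (signProblem ε hε).optRisk = 0 := by
  have hleast : IsLeast ((signProblem ε hε).risk '' (signProblem ε hε).domain)
      ((signProblem ε hε).risk 0) :=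
    ⟨Set.mem_image_of_mem _ (Set.mem_univ _), Set.forall_mem_image.2 isMinOn_risk⟩
  rw [StochConvexProblem.optRisk, hleast.csInf_eq, risk_eq]
  simp

theorem isLipschitz (hε1 : ε ≤ 1) : (signProblem ε hε).IsLipschitz 1 := by
  refine ae_of_all _ fun b x _ y _ => ?_
  calc |(1 - ε) * bitSign b * x 0 + ε * |x 0| - ((1 - ε) * bitSign b * y 0 + ε * |y 0|)|
      = |(1 - ε) * bitSign b * (x 0 - y 0) + ε * (|x 0| - |y 0|)| := by
        congr 1
        ring
    _ ≤ (1 - ε) * |x 0 - y 0| + ε * |(|x 0| - |y 0|)| := by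
        refine (abs_add_le _ _).trans_eq ?_
        simp only [abs_mul, abs_bitSign, abs_of_nonneg hε, abs_of_nonneg (sub_nonneg.2 hε1),
          mul_one]
    _ ≤ (1 - ε) * |x 0 - y 0| + ε * |x 0 - y 0| :=
        add_le_add le_rfl (mul_le_mul_of_nonneg_left (abs_abs_sub_abs_le (x 0) (y 0)) hε)
    _ = 1 * ‖x - y‖ := by
        rw [norm_euclideanSpace_fin_one, PiLp.sub_apply]
        ring

theorem isPosHomogeneous : (signProblem ε hε).IsPosHomogeneous where
  smul_mem _ _ _ _ := Set.mem_univ _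
  loss_smul c hc x _ s := by
    simp only [signProblem, PiLp.smul_apply, smul_eq_mul, abs_mul, abs_of_nonneg hc]
    ring

theorem abs_subgradient_sub_le {x v : EuclideanSpace ℝ (Fin 1)} {b : Bool}
    (hv : (signProblem ε hε).IsSubgradient x b v) : |v 0 - (1 - ε) * bitSign b| ≤ ε := by
  have hslope (h : ℝ) : (v 0 - (1 - ε) * bitSign b) * h ≤ ε * |h| := by
    have hsub := hv (!₂[x 0 + h]) (Set.mem_univ _)
    have habs := mul_le_mul_of_nonneg_left (abs_add_le (x 0) h) hε
    simp only [signProblem, PiLp.inner_apply, Fin.sum_univ_one, PiLp.sub_apply,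
      RCLike.inner_apply, conj_trivial, Matrix.cons_val_fin_one] at hsub
    linarith
  have hright := hslope 1
  have hleft := hslope (-1)
  rw [abs_one] at hright
  rw [abs_neg, abs_one] at hleft
  exact abs_le.2 ⟨by linarith, by linarith⟩

theorem bitSign_mul_subgradient_mem_Icc (hg : (signProblem ε hε).IsSubgradientOracle g)
    (x : EuclideanSpace ℝ (Fin 1)) (b : Bool) :
    1 - 2 * ε ≤ bitSign b * g x b 0 ∧ bitSign b * g x b 0 ≤ 1 := by
  have hgx := abs_subgradient_sub_le (ae_fairBit_iff.1 hg b x (Set.mem_univ _))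
  have hfactor : bitSign b * (g x b 0 - (1 - ε) * bitSign b) = bitSign b * g x b 0 - (1 - ε) := by
    linear_combination (-(1 - ε)) * bitSign_sq b
  have habs : |bitSign b * g x b 0 - (1 - ε)| ≤ ε := by
    rwa [← hfactor, abs_mul, abs_bitSign, one_mul]
  obtain ⟨hlower, hupper⟩ := abs_le.1 habs
  constructor <;> linarith

theorem adaSGD_eq_smul (hg : (signProblem ε hε).IsSubgradientOracle g) {R : ℝ} (hR : 0 < R) (n : ℕ)
    (z : ℕ → Bool) :
    (signProblem ε hε).adaSGD g R n z = R • (signProblem ε hε).adaSGD g 1 n z :=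
  isPosHomogeneous.adaSGD_eq_smul
    (fun _ hc _ hx s => isPosHomogeneous.subgradient_smul (ae_fairBit_iff.1 hg s) hc hx) hR n z

theorem empRisk_eq (n : ℕ) (z : ℕ → Bool) (x : EuclideanSpace ℝ (Fin 1)) :
    (signProblem ε hε).empRisk n z x =
      1 / n * ((1 - ε) * (x 0 * ∑ i : Fin n, bitSign (z (i + 1))) + ε * (n * |x 0|)) := by
  have hsum : ∑ i : Fin n, bitSign (z (i + 1)) = ∑ i ∈ Finset.Icc 1 n, bitSign (z i) := by
    rw [Fin.sum_univ_eq_sum_range fun i => bitSign (z (i + 1)), Finset.range_eq_Ico,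
      Finset.sum_Ico_add' (fun i => bitSign (z i)) 0 n 1, zero_add,
      Finset.Ico_add_one_right_eq_Icc]
  simp only [StochConvexProblem.empRisk, signProblem, hsum, Finset.sum_add_distrib,
    Finset.sum_const, Nat.card_Icc, add_tsub_cancel_right, ← Finset.sum_mul, ← Finset.mul_sum,
    nsmul_eq_mul]
  ring

theorem empRisk_neg {n : ℕ} {z : ℕ → Bool} {x : EuclideanSpace ℝ (Fin 1)}
    (hx : x 0 * ∑ i : Fin n, bitSign (z (i + 1)) < 0)
    (hz : ε * n < (1 - ε) * |∑ i : Fin n, bitSign (z (i + 1))|) :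
    (signProblem ε hε).empRisk n z x < 0 := by
  have hn : 0 < n := Nat.pos_of_ne_zero fun h => by
    subst h
    simp at hx
  rw [empRisk_eq]
  refine mul_neg_of_pos_of_neg (by positivity) ?_
  have hxpos : 0 < |x 0| := abs_pos.2 (left_ne_zero_of_mul hx.ne)
  rw [← neg_neg (x 0 * _), ← abs_of_neg hx, abs_mul]
  nlinarith

theorem le_abs_adaSGD_and_empRisk_neg_of_isMisleading {n : ℕ} (hn : 3000 ≤ n)
    (hεn : ε * (28 * √(n : ℝ)) = 1) (hg : (signProblem ε hε).IsSubgradientOracle g)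
    {train valid : ℕ → Bool}
    (h : IsMisleading (fun i : Fin n => train (i + 1)) fun i => valid (i + 1)) :
    28 / 288 ≤ |(signProblem ε hε).adaSGD g 1 n train 0| ∧
      (signProblem ε hε).empRisk n valid ((signProblem ε hε).adaSGD g 1 n train) < 0 := by
  obtain ⟨htrain, hvalid, hsigns⟩ := h
  have hn' : (3000 : ℝ) ≤ n := by exact_mod_cast hn
  have hsqrt : 54 ≤ √(n : ℝ) := Real.le_sqrt_of_sq_le (by linarith)
  have hε1 : ε ≤ 1 / 1512 := by nlinarith
  have hκ : 0 < 1 - 2 * ε := by linarith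
  have hclose : |(signProblem ε hε).adaSGD g 1 n train 0 -
      meanInvSqrtWalk fun i : Fin n => train (i + 1)| ≤ 96 / 1000 := by
    refine (abs_adaSGD_sub_meanInvSqrtWalk_le rfl hκ
      (bitSign_mul_subgradient_mem_Icc hg) n train).trans ?_
    have hrate : 4 / 3 * (1 / (1 - 2 * ε) - 1) * √(n : ℝ) = 2 / 21 / (1 - 2 * ε) := by
      field_simp
      linarith
    rw [hrate, div_le_iff₀ hκ]
    linarith
  obtain ⟨hfar, hsigns'⟩ :=
    le_abs_and_mul_neg_of_abs_sub_le htrain hsigns hclose (by norm_num)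
  refine ⟨hfar.trans' (by norm_num), empRisk_neg hsigns' ?_⟩
  calc ε * n = √(n : ℝ) / 28 := by
        linear_combination √(n : ℝ) / 28 * hεn - ε * Real.mul_self_sqrt (by linarith : (0 : ℝ) ≤ n)
    _ < (1 - ε) * (√(n : ℝ) / 20) := by nlinarith
    _ ≤ _ := by
        gcongr
        linarith

end signProblem

theorem mainTheorem4_general (n : ℕ) (hn : 3000 ≤ n) :
    ∃ P : StochConvexProblem 1 Bool, P.IsLipschitz 1 ∧ IsMinOn P.risk P.domain 0 ∧
      ∀ g : EuclideanSpace ℝ (Fin 1) → Bool → EuclideanSpace ℝ (Fin 1), P.IsSubgradientOracle g →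
      ∀ (Ω : Type*) [MeasurableSpace Ω] (μ : Measure Ω) [IsProbabilityMeasure μ]
        (S : ℕ → Ω → Bool),
        (∀ i ∈ Finset.Icc 1 (2 * n), HasLaw (S i) P.law μ) →
        iIndepFun (fun i : Finset.Icc 1 (2 * n) => S i) μ →
        WithProbAtLeast μ (1 / 1000) (fun ω =>
          ∀ (ι : Type*) (η : ι → ℝ), (∀ k, 0 < η k) →
          ∀ k ∈ P.greedySelection n (fun i => S i ω)
              (fun k => P.adaSGD g (η k) n (fun t => S (n + t) ω)),
            ∀ j, 1 / (288 * √(n : ℝ)) * η j ≤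
              P.risk (P.adaSGD g (η k) n (fun t => S (n + t) ω)) - P.optRisk) := by
  have hsqrt : 1 ≤ √(n : ℝ) := Real.one_le_sqrt.2 (by exact_mod_cast (by omega : 1 ≤ n))
  obtain ⟨ε, hεn⟩ : ∃ ε : ℝ, ε * (28 * √(n : ℝ)) = 1 := ⟨_, inv_mul_cancel₀ (by positivity)⟩
  have hε : 0 ≤ ε := by nlinarith
  refine ⟨signProblem ε hε, signProblem.isLipschitz (by nlinarith), signProblem.isMinOn_risk, ?_⟩
  intro g hg Ω _ μ _ S hlaw hindep
  obtain ⟨A, hA, hAμ, hmisleading⟩ := withProbAtLeast_isMisleading hn hlaw hindep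
  refine ⟨A, hA, hAμ, fun ω hω ι η hη k hk j => ?_⟩
  obtain ⟨hfar, hneg⟩ := signProblem.le_abs_adaSGD_and_empRisk_neg_of_isMisleading
    (train := fun t => S (n + t) ω) (valid := fun i => S i ω) hn hεn hg (hmisleading ω hω)
  simp only [signProblem.adaSGD_eq_smul hg (hη _)] at hk ⊢
  have hjk : η j ≤ η k :=
    signProblem.isPosHomogeneous.le_of_mem_greedySelection_smul (Set.mem_univ _) hneg hη hk j
  rw [signProblem.risk_eq, signProblem.optRisk_eq, sub_zero, PiLp.smul_apply, smul_eq_mul, abs_mul,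
    abs_of_pos (hη k)]
  calc 1 / (288 * √(n : ℝ)) * η j = ε * (η j * (28 / 288)) := by
        field_simp
        linear_combination (-η j) * hεn
    _ ≤ _ := by
        gcongr
        exact (hη k).le

theorem mainTheorem4 (n : ℕ) (hn : 3000 ≤ n) (K : ℕ) (η : Fin (K + 1) → ℝ) (hη : ∀ k, 0 < η k) :
    ∃ (d : ℕ) (𝒮 : Type) (_ : MeasurableSpace 𝒮) (P : StochConvexProblem d 𝒮),
      P.IsLipschitz 1 ∧ IsMinOn P.risk P.domain 0 ∧
      ∀ g : EuclideanSpace ℝ (Fin d) → 𝒮 → EuclideanSpace ℝ (Fin d), P.IsSubgradientOracle g →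
      ∀ (Ω : Type*) [MeasurableSpace Ω] (μ : Measure Ω) [IsProbabilityMeasure μ]
        (S : ℕ → Ω → 𝒮),
        (∀ i ∈ Finset.Icc 1 (2 * n), HasLaw (S i) P.law μ) →
        iIndepFun (fun i : Finset.Icc 1 (2 * n) => S i) μ →
        WithProbAtLeast μ (1 / 1000) (fun ω =>
          ∀ k ∈ P.greedySelection n (fun i => S i ω)
              (fun k => P.adaSGD g (η k) n (fun t => S (n + t) ω)),
            1 / (288 * √(n : ℝ)) * (⨆ k, η k) ≤
              P.risk (P.adaSGD g (η k) n (fun t => S (n + t) ω)) - P.optRisk) := by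
  obtain ⟨P, hLip, hmin, hP⟩ := mainTheorem4_general n hn
  refine ⟨1, Bool, inferInstance, P, hLip, hmin, fun g hg Ω _ μ _ S hlaw hindep => ?_⟩
  obtain ⟨A, hA, hAμ, hgap⟩ := hP g hg Ω μ S hlaw hindep
  exact ⟨A, hA, hAμ, fun ω hω k hk => (Real.mul_iSup_of_nonneg (by positivity) η).trans_le
    (ciSup_le (hgap ω hω _ η hη k hk))⟩
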